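/- Let $\pi\subset\mathrm{Iso}(\mathbb R^n)=\mathsf O(n)\ltimes\mathbb R^n$ be a crystallographic group, that is, a discrete group of rigid motions acting cocompactly on $\mathbb R^n$, so that $\mathcal O=\mathbb R^n/\pi$ is a closed flat orbifold. Let $H_\pi\subset\mathsf O(n)$ be its holonomy group, i.e. the group of linear parts $A$ of the elements $x\mapsto Ax+v$ of $\pi$, and set $\mathcal C_\pi=\{A\in\mathsf{GL}(n,\mathbb R): A\,H_\pi\,A^{-1}\subset\mathsf O(n)\}$. The Teichmüller space of flat metrics on $\mathcal O$ is the orbit space $\mathcal T_{\rm flat}(\mathcal O)=\mathsf O(n)\backslash\mathcal C_\pi$ of the action of $\mathsf O(n)$ on $\mathcal C_\pi$ by left multiplication. The orthogonal representation of $H_\pi$ on $\mathbb R^n$ has a decomposition $\mathbb R^n=\bigoplus_{i=1}^{l}W_i$, $W_i=\bigoplus_{j=1}^{m_i}V_{i,j}$, $m_i\ge1$, where the $V_{i,j}$ are irreducible subrepresentations, $V_{i,j}\cong V_{i',j'}$ if and only if $i=i'$, and for each $i$ the algebra $\mathrm{End}_{H_\pi}(V_{i,j})$ of equivariant endomorphisms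 is isomorphic to $\mathbb K_i$ for one of $\mathbb K_i=\mathbb R,\mathbb C,\mathbb H$ (so the $W_i$ are the isotypic components, each consisting of $m_i$ copies of an irreducible of real, complex or quaternionic type). For every such decomposition, $\mathcal T_{\rm flat}(\mathcal O)$ is a real-analytic manifold, with the quotient structure for which the projection $\mathcal C_\pi\to\mathcal T_{\rm flat}(\mathcal O)$ is a real-analytic submersion, and there is a (real-analytic) diffeomorphism $$\mathcal T_{\rm flat}(\mathcal O)\;\cong\;\prod_{i=1}^{l}\frac{\mathsf{GL}(m_i,\mathbb K_i)}{\mathsf O(m_i,\mathbb K_i)},$$ where $\mathsf{GL}(m,\mathbb K)$ is the group of invertible $m\times m$ matrices over $\mathbb K$, $\mathsf O(m,\mathbb K)$ stands for $\mathsf O(m)$, $\mathsf U(m)$ or $\mathsf{Sp}(m)$ when $\mathbb K$ is $\mathbb R$, $\mathbb C$ or $\mathbb H$ respectively, and each factor carries its quotient real-analytic structure. In particular, $\mathcal T_{\rm flat}(\mathcal O)$ is (real-analytically) diffeomorphic to $\mathbb R^d$, where $d=\sum_{i=1}^{l}d_i$ and $d_i=\tfrac12m_i(m_i+1)$, $m_i^2$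 or $m_i(2m_i-1)$ when $\mathbb K_i$ is $\mathbb R$, $\mathbb C$ or $\mathbb H$ respectively. -/

import Mathlib

open scoped Manifold ContDiff Topology Quaternion

noncomputable section

namespace FlatTeichmuller

/-- Euclidean space `ℝⁿ`. -/
abbrev Euc (n : ℕ) : Type := EuclideanSpace ℝ (Fin n)

/-- The subgroup of unitary elements `{u | u* u = u u* = 1}` of the group of units of a monoid with
involution. It is `O(n)` for the algebra of linear endomorphisms of `ℝⁿ` (whose involution is the
adjoint), and `O(m)`, `U(m)`, `Sp(m)` for the `m × m` matrices over `ℝ`, `ℂ`, `ℍ` (whose involution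
is the conjugate transpose). -/
def unitarySubgroup (R : Type) [Monoid R] [StarMul R] : Subgroup Rˣ :=
  (Unitary.toUnits : unitary R →* Rˣ).range

/-! ### Crystallographic groups, holonomy and Teichmüller space -/

/-- `GL(n)`, as the group of invertible linear endomorphisms of `ℝⁿ`. -/
abbrev GLn (n : ℕ) : Type := (Euc n →L[ℝ] Euc n)ˣ

/-- `O(n)`, as a subgroup of `GL(n)`. -/
abbrev On (n : ℕ) : Subgroup (GLn n) := unitarySubgroup (Euc n →L[ℝ] Euc n)

/-- The group `Iso(ℝⁿ)` of rigid motions of `ℝⁿ`. -/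
abbrev Iso (n : ℕ) : Type := Euc n ≃ᵃⁱ[ℝ] Euc n

/-- The projection `(A, v) ↦ A` from rigid motions to their linear parts. -/
def linearPart (n : ℕ) : Iso n →* GLn n where
  toFun g := (ContinuousLinearEquiv.unitsEquiv ℝ (Euc n)).symm
    g.linearIsometryEquiv.toContinuousLinearEquiv
  map_one' := by ext; rfl
  map_mul' g h := by ext; rfl

/-- A crystallographic group: a discrete group of rigid motions of `ℝⁿ` that acts cocompactly.
A rigid motion `x ↦ A x + v` is determined by the pair `(A, v)`, and the topology of the group of
rigid motions is that of these pairs. -/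
structure IsCrystallographic {n : ℕ} (π : Subgroup (Iso n)) : Prop where
  discrete : IsDiscrete ((fun g : Iso n =>
    (((linearPart n g : GLn n) : Euc n →L[ℝ] Euc n), g 0)) '' (π : Set (Iso n)))
  cocompact : ∃ K : Set (Euc n), IsCompact K ∧ ∀ x : Euc n, ∃ g ∈ π, g x ∈ K

/-- The holonomy group `H_π`: the group of linear parts of the elements of `π`. -/
def holonomy {n : ℕ} (π : Subgroup (Iso n)) : Subgroup (GLn n) := π.map (linearPart n)

/-- The cone `C_π = {A ∈ GL(n) | A H_π A⁻¹ ⊆ O(n)}`, with the action of `O(n)` by left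
multiplication. -/
def cone {n : ℕ} (π : Subgroup (Iso n)) : SubMulAction (On n) (GLn n) where
  carrier := {A | ∀ h ∈ holonomy π, A * h * A⁻¹ ∈ On n}
  smul_mem' := by
    intro u A hA h hh
    have key : (u • A) * h * (u • A)⁻¹ = (u : GLn n) * (A * h * A⁻¹) * (u : GLn n)⁻¹ := by
      change ((u : GLn n) * A) * h * ((u : GLn n) * A)⁻¹ = _
      group
    rw [key]
    exact (On n).mul_mem ((On n).mul_mem u.2 (hA h hh)) ((On n).inv_mem u.2)

/-- The Teichmüller space `O(n) \ C_π` of flat metrics on the flat orbifold `ℝⁿ / π`, with the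
quotient topology. -/
abbrev Teich {n : ℕ} (π : Subgroup (Iso n)) : Type :=
  Quotient (MulAction.orbitRel (On n) (cone π))

/-- The projection `C_π → O(n) \ C_π`. -/
def teichMk {n : ℕ} (π : Subgroup (Iso n)) (A : cone π) : Teich π :=
  Quotient.mk (MulAction.orbitRel (On n) (cone π)) A

/-- The inclusion of `C_π` in the vector space of linear endomorphisms of `ℝⁿ`. -/
def coneIncl {n : ℕ} (π : Subgroup (Iso n)) (A : cone π) : Euc n →L[ℝ] Euc n :=
  ((A : GLn n) : Euc n →L[ℝ] Euc n)

/-! ### The division algebras `ℝ`, `ℂ`, `ℍ` and the spaces `GL(m, 𝕂) / O(m, 𝕂)` -/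

/-- The three possible types of a real irreducible representation. -/
inductive DivType where
  | real
  | complex
  | quaternionic

/-- The division algebra `ℝ`, `ℂ` or `ℍ` of a given type. -/
def DivType.Alg : DivType → Type
  | .real => ℝ
  | .complex => ℂ
  | .quaternionic => ℍ[ℝ]

instance DivType.instNormedDivisionRing : (K : DivType) → NormedDivisionRing K.Alg
  | .real => inferInstanceAs (NormedDivisionRing ℝ)
  | .complex => inferInstanceAs (NormedDivisionRing ℂ)
  | .quaternionic => inferInstanceAs (NormedDivisionRing ℍ[ℝ])

instance DivType.instNormedAlgebra : (K : DivType) → NormedAlgebra ℝ K.Alg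
  | .real => inferInstanceAs (NormedAlgebra ℝ ℝ)
  | .complex => inferInstanceAs (NormedAlgebra ℝ ℂ)
  | .quaternionic => inferInstanceAs (NormedAlgebra ℝ ℍ[ℝ])

/-- The conjugation of `ℝ` (trivial), `ℂ` or `ℍ`. -/
instance DivType.instStarRing : (K : DivType) → StarRing K.Alg
  | .real => inferInstanceAs (StarRing ℝ)
  | .complex => inferInstanceAs (StarRing ℂ)
  | .quaternionic => inferInstanceAs (StarRing ℍ[ℝ])

/-- The homogeneous space `GL(m, 𝕂) / O(m, 𝕂)` of left cosets, with the quotient topology. -/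
abbrev HomSpace (m : ℕ) (K : DivType) : Type :=
  GL (Fin m) K.Alg ⧸ unitarySubgroup (Matrix (Fin m) (Fin m) K.Alg)

/-- The projection `GL(m, 𝕂) → GL(m, 𝕂) / O(m, 𝕂)`. -/
def homMk (m : ℕ) (K : DivType) (A : GL (Fin m) K.Alg) : HomSpace m K :=
  QuotientGroup.mk A

/-- The inclusion of `GL(m, 𝕂)` in the real vector space of `m × m` arrays of elements of `𝕂`. -/
def glIncl (m : ℕ) (K : DivType) (A : GL (Fin m) K.Alg) : Fin m → Fin m → K.Alg :=
  fun i j => (A : Matrix (Fin m) (Fin m) K.Alg) i j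

/-- The dimension of `GL(m, 𝕂) / O(m, 𝕂)`. -/
def homDim (m : ℕ) : DivType → ℕ
  | .real => m * (m + 1) / 2
  | .complex => m ^ 2
  | .quaternionic => m * (2 * m - 1)

/-! ### Quotient manifolds -/

/-- Let `P` be a subset of a normed space `V`, with inclusion `ι : P → V`, and let `p : P → X` be a
map onto a quotient of `P`. The given charts on `X` make `X` the real-analytic quotient manifold of
`P`: they form a real-analytic atlas, `p` is real-analytic (near every point of `P` it is the
restriction of a real-analytic map defined on an open subset of `V`), and `p` is a submersion
(through every point of `P` there is a real-analytic local section of `p`). There is at most one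
real-analytic structure with these properties, as the identity of `X` is locally the composite of a
local section for one structure and a local extension of `p` for the other. -/
structure IsAnalyticQuotient {P V X : Type} [NormedAddCommGroup V] [NormedSpace ℝ V]
    [TopologicalSpace X] {d : ℕ} (charts : ChartedSpace (Euc d) X) (ι : P → V) (p : P → X) :
    Prop where
  isManifold : IsManifold (𝓡 d) ω X
  surjective : Function.Surjective p
  analytic : ∀ a : P, ∃ U : Set V, IsOpen U ∧ ι a ∈ U ∧
    ∃ F : V → X, ContMDiffOn 𝓘(ℝ, V) (𝓡 d) ω F U ∧ ∀ b : P, ι b ∈ U → F (ι b) = p b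
  submersion : ∀ a : P, ∃ O : Set X, IsOpen O ∧ p a ∈ O ∧
    ∃ s : X → P, s (p a) = a ∧ (∀ x ∈ O, p (s x) = x) ∧
      ContMDiffOn (𝓡 d) 𝓘(ℝ, V) ω (fun x => ι (s x)) O

/-! ### The holonomy representation and its isotypic components -/

/-- The orthogonal representation of the holonomy group on `ℝⁿ`. -/
def holonomyRep {n : ℕ} (π : Subgroup (Iso n)) : Representation ℝ (holonomy π) (Euc n) where
  toFun h := (((h : GLn n) : Euc n →L[ℝ] Euc n) : Euc n →ₗ[ℝ] Euc n)
  map_one' := rfl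
  map_mul' _ _ := rfl

/-- A decomposition `ℝⁿ = ⨁ᵢ ⨁ⱼ V i j`, `1 ≤ i ≤ l`, `1 ≤ j ≤ m i`, of the holonomy representation
into irreducible subrepresentations, where `V i j` and `V i' j'` are isomorphic if and only if
`i = i'`. Thus `W i = ⨁ⱼ V i j` are the isotypic components, each made of `m i` copies of the same
irreducible, and `K i` is the type of this irreducible: its algebra of equivariant endomorphisms is
isomorphic to `ℝ`, `ℂ` or `ℍ`. -/
structure IsotypicDecomposition {n : ℕ} (π : Subgroup (Iso n)) where
  l : ℕ
  m : Fin l → ℕ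
  K : Fin l → DivType
  V : (i : Fin l) → Fin (m i) → Subrepresentation (holonomyRep π)
  m_pos : ∀ i, 0 < m i
  isInternal : DirectSum.IsInternal (fun s : (i : Fin l) × Fin (m i) => (V s.1 s.2).toSubmodule)
  irreducible : ∀ i j, (V i j).toRepresentation.IsIrreducible
  equiv_iff : ∀ i j i' j',
    Nonempty ((V i j).toRepresentation.Equiv (V i' j').toRepresentation) ↔ i = i'
  type_eq : ∀ i j, Nonempty
    (Representation.IntertwiningMap (V i j).toRepresentation (V i j).toRepresentation
      ≃ₐ[ℝ] (K i).Alg)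

/-- The dimension `d = ∑ᵢ dim GL(mᵢ, 𝕂ᵢ) / O(mᵢ, 𝕂ᵢ)`. -/
def IsotypicDecomposition.dim {n : ℕ} {π : Subgroup (Iso n)} (D : IsotypicDecomposition π) : ℕ :=
  ∑ i, homDim (D.m i) (D.K i)

end FlatTeichmuller

end

open FlatTeichmuller

noncomputable section

set_option linter.unusedSectionVars false

namespace FlatTeichmuller

/-! Both sides of the diffeomorphism are identified with positive cones of real star-algebras of
operators, each such cone is a vector space in disguise, and then only dimensions have to be
compared.

By the polar decomposition, `A ↦ A* A` has the `O(n)`-orbits as its fibres. Since elements of the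
holonomy group are orthogonal, `A` lies in `C_π` exactly when `A* A` commutes with that group
(`mem_cone_iff`, `teichMk_eq_iff`). So Teichmüller space is the cone of positive definite elements
of the commutant of the holonomy group. In the same way `A ↦ A A*` identifies `GL(m, 𝕂) / O(m, 𝕂)`
with the positive definite Hermitian matrices, seen as operators on `𝕂ᵐ`. Analytic sections come
from the positive square root, which is analytic by the inverse function theorem
(`contDiffOn_symSqrt`).

The positive cone of a star-algebra is open in its selfadjoint part, and `X ↦ X - X⁻¹` maps it
diffeomorphically onto this vector space (`exists_analytic_equiv_posPart_symPart`). Hence all the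
quotients have a global chart (`exists_globalChart_isAnalyticQuotient`), and a linear isomorphism
between the chart spaces gives the diffeomorphism with the product.

The dimensions agree because both are counts of symmetric arrays (`two_mul_finrank_symmArray`). A
selfadjoint equivariant operator is an array of equivariant maps between irreducible summands: by
Schur's lemma the diagonal entries are real scalars, and an off-diagonal entry ranges over a copy of
`𝕂ᵢ` within an isotypic component and vanishes between different ones. A Hermitian matrix over `𝕂`
also has real diagonal and free entries above it.

Decompositions exist by splitting off invariant subspaces of least dimension. The types `ℝ`, `ℂ`,
`ℍ` come from Frobenius' argument, applied to the endomorphism algebra with the adjoint as positive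
involution. -/

/-! ### Positive definite operators -/

section PosDef

variable {E : Type*} [NormedAddCommGroup E] [InnerProductSpace ℝ E] [CompleteSpace E]

/-- A selfadjoint operator with `⟪T v, v⟫ > 0` for all `v ≠ 0`. -/
structure IsPosDef (T : E →L[ℝ] E) : Prop where
  isSelfAdjoint : IsSelfAdjoint T
  inner_pos : ∀ v, v ≠ 0 → 0 < inner ℝ (T v) v

lemma inner_star_apply (T : E →L[ℝ] E) (x y : E) :
    inner ℝ ((star T) x) y = inner ℝ x (T y) :=
  ContinuousLinearMap.adjoint_inner_left T y x

lemma _root_.IsSelfAdjoint.inner_apply_comm {T : E →L[ℝ] E} (hT : IsSelfAdjoint T) (x y : E) :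
    inner ℝ (T x) y = inner ℝ x (T y) := by
  conv_lhs => rw [← hT.star_eq]
  exact inner_star_apply T x y

lemma isPosDef_star_mul_self {u : E →L[ℝ] E} (hu : Function.Injective u) :
    IsPosDef (star u * u) := by
  refine ⟨IsSelfAdjoint.star_mul_self u, fun v hv => ?_⟩
  rw [mul_apply_eq_comp, inner_star_apply]
  exact real_inner_self_pos.2 fun h => hv (hu (h.trans (map_zero u).symm))

lemma injective_of_isUnit {u : E →L[ℝ] E} (hu : IsUnit u) : Function.Injective u := by
  obtain ⟨u, rfl⟩ := hu
  intro x y h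
  simpa [← mul_apply_eq_comp] using congrArg (↑u⁻¹ : E →L[ℝ] E) h

lemma isPosDef_star_mul_self_of_isUnit {u : E →L[ℝ] E} (hu : IsUnit u) :
    IsPosDef (star u * u) :=
  isPosDef_star_mul_self (injective_of_isUnit hu)

lemma isPosDef_self_mul_star_of_isUnit {u : E →L[ℝ] E} (hu : IsUnit u) :
    IsPosDef (u * star u) := by
  simpa using isPosDef_star_mul_self_of_isUnit hu.star

namespace IsPosDef

lemma injective {T : E →L[ℝ] E} (hT : IsPosDef T) : Function.Injective T := by
  rw [injective_iff_map_eq_zero]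
  intro v hv
  by_contra h
  simpa [hv] using hT.inner_pos v h

lemma add {S T : E →L[ℝ] E} (hS : IsPosDef S) (hT : IsPosDef T) : IsPosDef (S + T) := by
  refine ⟨hS.isSelfAdjoint.add hT.isSelfAdjoint, fun v hv => ?_⟩
  rw [add_apply, inner_add_left]
  exact add_pos (hS.inner_pos v hv) (hT.inner_pos v hv)

lemma star_mul_mul {T u : E →L[ℝ] E} (hT : IsPosDef T) (hu : IsUnit u) :
    IsPosDef (star u * T * u) := by
  refine ⟨hT.isSelfAdjoint.conjugate' u, fun v hv => ?_⟩
  rw [mul_assoc, mul_apply_eq_comp, inner_star_apply]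
  exact hT.inner_pos _ fun h => hv (injective_of_isUnit hu (h.trans (map_zero u).symm))

variable [FiniteDimensional ℝ E]

lemma isUnit {T : E →L[ℝ] E} (hT : IsPosDef T) : IsUnit T := by
  have hbij : Function.Bijective (T : E →ₗ[ℝ] E) :=
    ⟨hT.injective, LinearMap.surjective_of_injective (f := (T : E →ₗ[ℝ] E)) hT.injective⟩
  let e := (LinearEquiv.ofBijective (T : E →ₗ[ℝ] E) hbij).toContinuousLinearEquiv
  refine ⟨(ContinuousLinearEquiv.unitsEquiv ℝ E).symm e, ?_⟩
  ext x
  rfl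

end IsPosDef

variable [FiniteDimensional ℝ E]

lemma eq_zero_of_eigenvalues_eq_zero {h : E →L[ℝ] E} (hh : IsSelfAdjoint h)
    (H : ∀ (c : ℝ) (v : E), v ≠ 0 → h v = c • v → c = 0) : h = 0 := by
  have hs : (h : E →ₗ[ℝ] E).IsSymmetric := ContinuousLinearMap.isSelfAdjoint_iff_isSymmetric.1 hh
  suffices (h : E →ₗ[ℝ] E) = 0 by ext x; exact LinearMap.congr_fun this x
  refine (hs.eigenvectorBasis rfl).toBasis.ext fun i => ?_
  have h1 := hs.apply_eigenvectorBasis rfl i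
  have h2 := H _ _ ((hs.eigenvectorBasis rfl).orthonormal.ne_zero i) h1
  simp [h1] at h2 ⊢
  exact Or.inl h2

/-- A homogeneous Sylvester equation with positive definite coefficients has no nonzero selfadjoint
solution. -/
lemma eq_zero_of_mul_add_mul_eq_zero {a b h : E →L[ℝ] E} (ha : IsPosDef a) (hb : IsPosDef b)
    (hh : IsSelfAdjoint h) (H : a * h + h * b = 0) : h = 0 := by
  refine eq_zero_of_eigenvalues_eq_zero hh fun c v hv hc => ?_
  -- Pairing the equation with an eigenvector of `h` leaves its eigenvalue times a positive number.
  have h1 : inner ℝ ((a * h + h * b) v) v = c * (inner ℝ (a v) v + inner ℝ (b v) v) := by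
    simp [inner_add_left, hh.inner_apply_comm, hc, inner_smul_left, inner_smul_right, mul_add]
  rw [H] at h1
  have h2 := ha.inner_pos v hv
  have h3 := hb.inner_pos v hv
  simp at h1
  rcases h1 with h1 | h1
  · exact h1
  · linarith

/-- If `a² = b²`, then `a (a - b) + (a - b) b = 0`, a homogeneous Sylvester equation for `a - b`. -/
lemma IsPosDef.eq_of_mul_self_eq {a b : E →L[ℝ] E} (ha : IsPosDef a) (hb : IsPosDef b)
    (H : a * a = b * b) : a = b := by
  refine sub_eq_zero.1 (eq_zero_of_mul_add_mul_eq_zero ha hb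
    (ha.isSelfAdjoint.sub hb.isSelfAdjoint) ?_)
  rw [mul_sub, sub_mul, H]
  abel

lemma isPosDef_of_eigenbasis {T : E →L[ℝ] E} (hT : IsSelfAdjoint T) {ι : Type*} [Fintype ι]
    (b : OrthonormalBasis ι ℝ E) {c : ι → ℝ} (hb : ∀ i, T (b i) = c i • b i)
    (hc : ∀ i, 0 < c i) : IsPosDef T := by
  refine ⟨hT, fun v hv => ?_⟩
  have h1 : T v = ∑ i, (c i * inner ℝ (b i) v) • b i := by
    conv_lhs => rw [← b.sum_repr' v]
    simp [hb, smul_smul, mul_comm]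
  rw [h1, sum_inner]
  simp only [inner_smul_left, RCLike.conj_to_real]
  obtain ⟨i, hi⟩ : ∃ i, inner ℝ (b i) v ≠ 0 := by
    by_contra hcon
    push Not at hcon
    apply hv
    rw [← b.sum_repr' v]
    simp [hcon]
  refine Finset.sum_pos' (fun i _ => ?_) ⟨i, Finset.mem_univ i, ?_⟩
  · rw [mul_assoc]
    exact mul_nonneg (hc i).le (mul_self_nonneg _)
  · rw [mul_assoc]
    exact mul_pos (hc i) (mul_self_pos.2 hi)

/-- The square root of a positive definite operator, as a polynomial in that operator. -/
lemma IsPosDef.exists_aeval_mul_self_eq {T : E →L[ℝ] E} (hT : IsPosDef T) :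
    ∃ p : Polynomial ℝ, IsPosDef (Polynomial.aeval T p) ∧
      Polynomial.aeval T p * Polynomial.aeval T p = T := by
  classical
  have hs : (T : E →ₗ[ℝ] E).IsSymmetric :=
    ContinuousLinearMap.isSelfAdjoint_iff_isSymmetric.1 hT.isSelfAdjoint
  set b := hs.eigenvectorBasis rfl with hb
  set ev := hs.eigenvalues rfl with hev
  have hTb : ∀ i, T (b i) = ev i • b i := fun i => hs.apply_eigenvectorBasis rfl i
  have hpos : ∀ i, 0 < ev i := fun i => by
    have := hT.inner_pos (b i) (b.orthonormal.ne_zero i)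
    rwa [hTb, inner_smul_left, real_inner_self_eq_norm_sq, b.orthonormal.1 i, one_pow, mul_one]
      at this
  -- The nodes are the distinct eigenvalues, so the polynomial interpolating the square root there
  -- acts on each eigenvector by the root of its eigenvalue.
  let s : Finset ℝ := Finset.univ.image ev
  let p : Polynomial ℝ := Lagrange.interpolate s id Real.sqrt
  have hp : ∀ i, p.eval (ev i) = √(ev i) := fun i =>
    Lagrange.eval_interpolate_at_node (v := id) Real.sqrt (Set.injOn_id _)
      (Finset.mem_image_of_mem _ (Finset.mem_univ i))
  have hgen : ∀ (q : Polynomial ℝ) i, (Polynomial.aeval T q) (b i) = q.eval (ev i) • b i := by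
    intro q i
    induction q using Polynomial.induction_on' with
    | add p q hp hq => simp [hp, hq, add_smul]
    | monomial k a =>
      have : ∀ k : ℕ, (T ^ k) (b i) = ev i ^ k • b i := by
        intro k
        induction k with
        | zero => simp
        | succ k ih => rw [pow_succ', mul_apply_eq_comp, ih, map_smul, hTb, smul_smul,
            pow_succ]
      rw [Polynomial.aeval_monomial, Polynomial.eval_monomial, mul_apply_eq_comp, this,
        map_smul, Algebra.algebraMap_eq_smul_one]
      simp [smul_smul, mul_comm]
  refine ⟨p, isPosDef_of_eigenbasis ?_ b (c := fun i => √(ev i)) (fun i => by rw [hgen, hp])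
    (fun i => Real.sqrt_pos.2 (hpos i)), ?_⟩
  · rw [IsSelfAdjoint]
    induction p using Polynomial.induction_on' with
    | add p q hp hq => simp [hp, hq]
    | monomial k a =>
      rw [Polynomial.aeval_monomial, Algebra.algebraMap_eq_smul_one]
      simp [hT.isSelfAdjoint.star_eq]
  · suffices ((Polynomial.aeval T p * Polynomial.aeval T p : E →L[ℝ] E) : E →ₗ[ℝ] E)
        = (T : E →ₗ[ℝ] E) by
      ext x; exact LinearMap.congr_fun this x
    refine b.toBasis.ext fun i => ?_
    simp [hgen, hp, hTb, smul_smul, Real.mul_self_sqrt (hpos i).le]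

/-- By homogeneity only unit vectors matter, and an open condition that holds along the compact unit
sphere persists near `T`. -/
lemma isOpen_setOf_inner_pos :
    IsOpen {T : E →L[ℝ] E | ∀ v, v ≠ 0 → 0 < inner ℝ (T v) v} := by
  have hK : IsCompact (Metric.sphere (0 : E) 1) := isCompact_sphere 0 1
  have : {T : E →L[ℝ] E | ∀ v, v ≠ 0 → 0 < inner ℝ (T v) v} =
      {T | ∀ v ∈ Metric.sphere (0 : E) 1, (T, v) ∈
        {q : (E →L[ℝ] E) × E | 0 < inner ℝ (q.1 q.2) q.2}} := by
    ext T
    simp only [Set.mem_ofPred_eq, mem_sphere_zero_iff_norm]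
    refine ⟨fun h v hv => h v (by rintro rfl; simp at hv), fun h v hv => ?_⟩
    have h1 := h (‖v‖⁻¹ • v) (by simp [norm_smul, hv])
    rw [map_smul, inner_smul_left, inner_smul_right] at h1
    have h2 : 0 < ‖v‖⁻¹ := by positivity
    simp only [RCLike.conj_to_real] at h1
    exact (mul_pos_iff_of_pos_left h2).1 ((mul_pos_iff_of_pos_left h2).1 h1)
  rw [this]
  refine isOpen_iff_mem_nhds.2 fun T hT => ?_
  have hopen : IsOpen {q : (E →L[ℝ] E) × E | 0 < inner ℝ (q.1 q.2) q.2} :=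
    isOpen_lt continuous_const (by fun_prop)
  exact hK.eventually_forall_of_forall_eventually fun v hv =>
    hopen.mem_nhds (hT v hv)

end PosDef

/-! ### The positive cone of a real star-algebra of operators -/

/-- Composing with such a retraction turns an analytic map whose values happen to lie in `W` into an
analytic map with codomain `W`. -/
lemma exists_continuousLinearMap_retraction {V : Type*} [NormedAddCommGroup V] [NormedSpace ℝ V]
    [FiniteDimensional ℝ V] (W : Submodule ℝ V) : ∃ P : V →L[ℝ] W, ∀ w : W, P w = w := by
  obtain ⟨g, hg⟩ := W.subtype.exists_leftInverse_of_injective W.ker_subtype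
  exact ⟨LinearMap.toContinuousLinearMap g, fun w => LinearMap.congr_fun hg w⟩

lemma exists_hasFDerivAt_mul_self {W A : Type*} [NormedAddCommGroup W] [NormedSpace ℝ W]
    [NormedRing A] [NormedAlgebra ℝ A] (i : W →L[ℝ] A) (P : A →L[ℝ] W) (a : W) :
    ∃ D : W →L[ℝ] W, HasFDerivAt (fun x => P (i x * i x)) D a ∧
      ∀ h, D h = P (i a * i h + i h * i a) :=
  ⟨_, P.hasFDerivAt.comp a (i.hasFDerivAt.mul' i.hasFDerivAt), fun h => by simp⟩

section Cone

variable {E : Type*} [NormedAddCommGroup E] [InnerProductSpace ℝ E] [CompleteSpace E]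

/-- The selfadjoint elements of a star-algebra of operators. -/
def symPart (R : StarSubalgebra ℝ (E →L[ℝ] E)) : Submodule ℝ (E →L[ℝ] E) where
  carrier := {T | T ∈ R ∧ IsSelfAdjoint T}
  add_mem' hS hT := ⟨add_mem hS.1 hT.1, hS.2.add hT.2⟩
  zero_mem' := ⟨zero_mem R, IsSelfAdjoint.zero _⟩
  smul_mem' c _ hT := ⟨R.toSubalgebra.smul_mem hT.1 c, (IsSelfAdjoint.all c).smul hT.2⟩

lemma mem_symPart {R : StarSubalgebra ℝ (E →L[ℝ] E)} {T : E →L[ℝ] E} :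
    T ∈ symPart R ↔ T ∈ R ∧ IsSelfAdjoint T := Iff.rfl

/-- The positive definite elements of a star-algebra of operators. -/
def posPart (R : StarSubalgebra ℝ (E →L[ℝ] E)) : Set (symPart R) :=
  {T | IsPosDef (T : E →L[ℝ] E)}

lemma mem_posPart {R : StarSubalgebra ℝ (E →L[ℝ] E)} {T : symPart R} :
    T ∈ posPart R ↔ IsPosDef (T : E →L[ℝ] E) := Iff.rfl

lemma contDiff_coe_symPart (R : StarSubalgebra ℝ (E →L[ℝ] E)) :
    ContDiff ℝ ω (fun x : symPart R => (x : E →L[ℝ] E)) := by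
  have h : ContDiff ℝ ω ((symPart R).subtypeL : symPart R → E →L[ℝ] E) :=
    ContinuousLinearMap.contDiff _
  exact h

variable [FiniteDimensional ℝ E]

lemma isOpen_posPart (R : StarSubalgebra ℝ (E →L[ℝ] E)) : IsOpen (posPart R) := by
  convert isOpen_setOf_inner_pos.preimage (continuous_subtype_val (p := (· ∈ symPart R))) using 1
  ext T
  exact ⟨fun h => h.inner_pos, fun h => ⟨T.2.2, h⟩⟩

/-- Left multiplication by `T` is injective on the finite-dimensional space `R`, hence surjective,
so `1` is a multiple `T x` with `x ∈ R`. -/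
lemma ringInverse_mem {R : StarSubalgebra ℝ (E →L[ℝ] E)} {T : E →L[ℝ] E} (hT : T ∈ R)
    (hu : IsUnit T) : Ring.inverse T ∈ R := by
  let W : Submodule ℝ (E →L[ℝ] E) := R.toSubalgebra.toSubmodule
  let f : W →ₗ[ℝ] W := (LinearMap.mulLeft ℝ T).restrict fun x hx => R.mul_mem hT hx
  have hf : Function.Injective f := fun x y hxy =>
    Subtype.ext (hu.mul_left_cancel (congrArg Subtype.val hxy))
  obtain ⟨x, hx⟩ := LinearMap.surjective_of_injective hf ⟨1, R.one_mem⟩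
  have hx' : T * (x : E →L[ℝ] E) = 1 := congrArg Subtype.val hx
  have := x.2
  rwa [← Ring.inverse_mul_cancel_left T (x : E →L[ℝ] E) hu, hx', mul_one] at this

open Classical in
/-- The positive definite square root of a positive definite operator (and `0` for an operator that
is not positive definite). -/
def opSqrt (T : E →L[ℝ] E) : E →L[ℝ] E :=
  if h : IsPosDef T then Polynomial.aeval T h.exists_aeval_mul_self_eq.choose else 0

lemma isPosDef_opSqrt {T : E →L[ℝ] E} (hT : IsPosDef T) : IsPosDef (opSqrt T) := by
  rw [opSqrt, dif_pos hT]
  exact hT.exists_aeval_mul_self_eq.choose_spec.1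

lemma opSqrt_mul_self {T : E →L[ℝ] E} (hT : IsPosDef T) : opSqrt T * opSqrt T = T := by
  rw [opSqrt, dif_pos hT]
  exact hT.exists_aeval_mul_self_eq.choose_spec.2

lemma opSqrt_eq_of_mul_self_eq {a T : E →L[ℝ] E} (ha : IsPosDef a) (h : a * a = T) :
    opSqrt T = a := by
  have hT : IsPosDef T := by
    have := isPosDef_star_mul_self ha.injective
    rwa [ha.isSelfAdjoint.star_eq, h] at this
  exact (isPosDef_opSqrt hT).eq_of_mul_self_eq ha ((opSqrt_mul_self hT).trans h.symm)

/-- The root is a polynomial in `T`, so it stays in every subalgebra that contains `T`. -/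
lemma opSqrt_mem {R : StarSubalgebra ℝ (E →L[ℝ] E)} {T : E →L[ℝ] E} (hT : T ∈ R) :
    opSqrt T ∈ R := by
  rw [opSqrt]
  split_ifs with h
  · exact (Algebra.adjoin_le (S := R.toSubalgebra) (by simpa using hT))
      (Polynomial.aeval_mem_adjoin_singleton ℝ T)
  · exact zero_mem R

lemma commute_opSqrt {c T : E →L[ℝ] E} (h : Commute c T) : Commute c (opSqrt T) := by
  rw [opSqrt]
  split_ifs with hT
  · generalize hT.exists_aeval_mul_self_eq.choose = p
    induction p using Polynomial.induction_on' with
    | add p q hp hq => simpa using hp.add_right hq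
    | monomial k a =>
      rw [Polynomial.aeval_monomial]
      exact Commute.mul_right (Algebra.commutes a c).symm (h.pow_right k)
  · exact Commute.zero_right c

lemma isSelfAdjoint_opSqrt (T : E →L[ℝ] E) : IsSelfAdjoint (opSqrt T) := by
  by_cases hT : IsPosDef T
  · exact (isPosDef_opSqrt hT).isSelfAdjoint
  · rw [opSqrt, dif_neg hT]
    exact IsSelfAdjoint.zero _

/-- The square root on the selfadjoint part of a star-algebra of operators. -/
def symSqrt (R : StarSubalgebra ℝ (E →L[ℝ] E)) (T : symPart R) : symPart R :=
  ⟨opSqrt T, opSqrt_mem T.2.1, isSelfAdjoint_opSqrt _⟩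

lemma mul_self_mem_symPart {R : StarSubalgebra ℝ (E →L[ℝ] E)} {T : E →L[ℝ] E}
    (hT : T ∈ symPart R) : T * T ∈ symPart R := by
  refine ⟨mul_mem hT.1 hT.1, ?_⟩
  have := IsSelfAdjoint.star_mul_self T
  rwa [hT.2.star_eq] at this

/-- Inverse function theorem for squaring at the root `a`: the derivative `h ↦ a h + h a` is
injective on selfadjoint elements by the Sylvester lemma, hence invertible. -/
theorem contDiffOn_symSqrt (R : StarSubalgebra ℝ (E →L[ℝ] E)) :
    ContDiffOn ℝ ω (symSqrt R) (posPart R) := by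
  intro T hT
  refine ContDiffAt.contDiffWithinAt ?_
  obtain ⟨P, hP⟩ := exists_continuousLinearMap_retraction (symPart R)
  let sq : symPart R → symPart R := fun x => P ((x : E →L[ℝ] E) * x)
  have hsq : ∀ x, (sq x : E →L[ℝ] E) = x * x := fun x =>
    congrArg Subtype.val (hP ⟨_, mul_self_mem_symPart x.2⟩)
  have hval := contDiff_coe_symPart R
  have hsm : ContDiff ℝ ω sq := P.contDiff.comp (hval.mul hval)
  set a : symPart R := symSqrt R T with ha
  have hapos : IsPosDef (a : E →L[ℝ] E) := isPosDef_opSqrt hT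
  have hsqa : sq a = T := Subtype.ext ((hsq a).trans (opSqrt_mul_self hT))
  obtain ⟨D, hder, hDP⟩ := exists_hasFDerivAt_mul_self (symPart R).subtypeL P a
  have hD : ∀ h : symPart R, (D h : E →L[ℝ] E) = a * h + h * a := by
    intro h
    refine congrArg Subtype.val ((hDP h).trans (hP ⟨a * h + h * a,
      add_mem (mul_mem a.2.1 h.2.1) (mul_mem h.2.1 a.2.1), ?_⟩))
    rw [IsSelfAdjoint, star_add, star_mul, star_mul, a.2.2.star_eq, h.2.2.star_eq, add_comm]
  have hinj : Function.Injective (D : symPart R →ₗ[ℝ] symPart R) := by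
    rw [injective_iff_map_eq_zero]
    intro h hh
    refine Subtype.ext (eq_zero_of_mul_add_mul_eq_zero hapos hapos h.2.2 ?_)
    rw [← hD h]
    exact congrArg Subtype.val hh
  let e : symPart R ≃L[ℝ] symPart R :=
    (LinearEquiv.ofInjectiveEndo _ hinj).toContinuousLinearEquiv
  have he : HasFDerivAt sq (e : symPart R →L[ℝ] symPart R) a := by
    have : (e : symPart R →L[ℝ] symPart R) = D := by
      ext1 x
      rfl
    rw [this]
    exact hder
  have hn : (ω : WithTop ℕ∞) ≠ 0 := by simp
  have hloc := hsm.contDiffAt (x := a) |>.to_localInverse he hn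
  set Φ := hsm.contDiffAt (x := a) |>.toOpenPartialHomeomorph sq he hn with hΦ
  have hmemT : T ∈ Φ.target := by
    rw [← hsqa]
    exact hsm.contDiffAt.image_mem_toOpenPartialHomeomorph_target he hn
  have hsymm : Φ.symm T = a := by
    rw [← hsqa]
    exact hsm.contDiffAt.localInverse_apply_image he hn
  rw [hsqa] at hloc
  refine hloc.congr_of_eventuallyEq ?_
  have hcont : ContinuousAt Φ.symm T := Φ.symm.continuousAt hmemT
  -- Near `T` the local inverse still takes positive definite values, so by uniqueness of the
  -- positive root it coincides with the square root.
  have hev : ∀ᶠ y in 𝓝 T, Φ.symm y ∈ posPart R :=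
    hcont.eventually ((isOpen_posPart R).mem_nhds (by rw [hsymm]; exact hapos))
  filter_upwards [hev, Φ.open_target.mem_nhds hmemT] with y hy hy'
  have h1 : sq (Φ.symm y) = y := Φ.right_inv hy'
  refine Subtype.ext (opSqrt_eq_of_mul_self_eq hy ?_)
  rw [← hsq]
  exact congrArg Subtype.val h1

lemma isPosDef_mul_self_add_four {Y : E →L[ℝ] E} (hY : IsSelfAdjoint Y) :
    IsPosDef (Y * Y + (4 : ℝ) • (1 : E →L[ℝ] E)) := by
  refine ⟨?_, fun v hv => ?_⟩
  · have h1 := IsSelfAdjoint.star_mul_self Y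
    rw [hY.star_eq] at h1
    exact h1.add ((IsSelfAdjoint.all (4 : ℝ)).smul (IsSelfAdjoint.one _))
  · have h1 : inner ℝ ((Y * Y + (4 : ℝ) • (1 : E →L[ℝ] E)) v) v
        = inner ℝ (Y v) (Y v) + 4 * inner ℝ v v := by
      simp [inner_add_left, hY.inner_apply_comm, inner_smul_left]
    rw [h1]
    have := real_inner_self_pos.2 hv
    have := real_inner_self_nonneg (x := Y v)
    linarith

/-- Every eigenvalue `c` of `g` satisfies `c + c⁻¹ > 0`, which excludes negative `c`. -/
lemma isPosDef_of_add_inverse {g k : E →L[ℝ] E} (hg : IsSelfAdjoint g) (hgk : k * g = 1)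
    (h : IsPosDef (g + k)) : IsPosDef g := by
  have hs : (g : E →ₗ[ℝ] E).IsSymmetric := ContinuousLinearMap.isSelfAdjoint_iff_isSymmetric.1 hg
  set b := hs.eigenvectorBasis rfl with hb
  set ev := hs.eigenvalues rfl with hev
  have hgb : ∀ i, g (b i) = ev i • b i := fun i => hs.apply_eigenvectorBasis rfl i
  have hpos : ∀ i, 0 < ev i := fun i => by
    have h1 : ev i • k (b i) = b i := by
      rw [← map_smul, ← hgb, ← mul_apply_eq_comp, hgk]
      rfl
    have h0 : ev i ≠ 0 := by
      intro h0
      rw [h0, zero_smul] at h1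
      exact b.orthonormal.ne_zero i h1.symm
    have h2 : k (b i) = (ev i)⁻¹ • b i := by
      rw [← h1, smul_smul, inv_mul_cancel₀ h0, one_smul, h1]
    have h3 := h.inner_pos (b i) (b.orthonormal.ne_zero i)
    rw [add_apply, hgb, h2, ← add_smul, inner_smul_left, real_inner_self_eq_norm_sq,
      b.orthonormal.1 i, one_pow, mul_one] at h3
    by_contra hcon
    have h4 : ev i < 0 := lt_of_le_of_ne (not_lt.1 hcon) h0
    have h5 := inv_lt_zero.2 h4
    simp only [RCLike.conj_to_real] at h3
    linarith
  exact isPosDef_of_eigenbasis hg b hgb hpos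

/-- The positive cone of a star-algebra of operators is real-analytically diffeomorphic to the space
of selfadjoint elements, by the map `X ↦ X - X⁻¹` with inverse `Y ↦ (Y + √(Y² + 4)) / 2`. -/
theorem exists_analytic_equiv_posPart_symPart (R : StarSubalgebra ℝ (E →L[ℝ] E)) :
    ∃ F G : symPart R → symPart R, ContDiffOn ℝ ω F (posPart R) ∧ ContDiff ℝ ω G ∧
      (∀ Y, G Y ∈ posPart R) ∧ (∀ Y, F (G Y) = Y) ∧ ∀ X ∈ posPart R, G (F X) = X := by
  obtain ⟨P, hP⟩ := exists_continuousLinearMap_retraction (symPart R)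
  have hval := contDiff_coe_symPart R
  let F : symPart R → symPart R := fun X => P ((X : E →L[ℝ] E) - Ring.inverse (X : E →L[ℝ] E))
  -- The constant `4` comes from `(X - X⁻¹)² + 4 = (X + X⁻¹)²`.
  let D : symPart R → symPart R := fun Y => P ((Y : E →L[ℝ] E) * Y + (4 : ℝ) • (1 : E →L[ℝ] E))
  let G : symPart R → symPart R := fun Y => (1 / 2 : ℝ) • (Y + symSqrt R (D Y))
  have hF : ∀ X ∈ posPart R, (F X : E →L[ℝ] E) = (X : E →L[ℝ] E) - Ring.inverse (X : E →L[ℝ] E) :=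
    fun X hX => congrArg Subtype.val (hP ⟨_, sub_mem X.2.1 (ringInverse_mem X.2.1 hX.isUnit),
      X.2.2.sub X.2.2.ringInverse⟩)
  have hD : ∀ Y, (D Y : E →L[ℝ] E) = (Y : E →L[ℝ] E) * Y + (4 : ℝ) • (1 : E →L[ℝ] E) :=
    fun Y => congrArg Subtype.val (hP ⟨_, add_mem (mul_mem Y.2.1 Y.2.1)
      (R.toSubalgebra.smul_mem (one_mem R) 4), (isPosDef_mul_self_add_four Y.2.2).isSelfAdjoint⟩)
  have hDpos : ∀ Y, IsPosDef (D Y : E →L[ℝ] E) := fun Y => by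
    rw [hD]; exact isPosDef_mul_self_add_four Y.2.2
  have hG : ∀ Y, (G Y : E →L[ℝ] E) = (1 / 2 : ℝ) • ((Y : E →L[ℝ] E) + opSqrt (D Y)) :=
    fun Y => rfl
  have hcomm : ∀ Y : symPart R, Commute (Y : E →L[ℝ] E) (opSqrt (D Y)) := fun Y => by
    refine commute_opSqrt ?_
    rw [hD]
    exact ((Commute.refl _).mul_right (Commute.refl _)).add_right
      ((Commute.one_right _).smul_right _)
  have hT2 : ∀ Y : symPart R, opSqrt (D Y : E →L[ℝ] E) * opSqrt (D Y : E →L[ℝ] E)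
      = (Y : E →L[ℝ] E) * (Y : E →L[ℝ] E) + (4 : ℝ) • (1 : E →L[ℝ] E) := fun Y =>
    (opSqrt_mul_self (hDpos Y)).trans (hD Y)
  -- The inverse of `(√D + Y) / 2` is `(√D - Y) / 2`: as `Y` commutes with `√D`, the product is `(D
  -- - Y²) / 4 = 1`. The two add up to `√D`, from which positivity of `G Y` follows.
  have hkg : ∀ Y : symPart R, ((1 / 2 : ℝ) • (opSqrt (D Y : E →L[ℝ] E) - (Y : E →L[ℝ] E))) *
      (G Y : E →L[ℝ] E) = 1 := by
    intro Y
    rw [hG, smul_mul_smul_comm, sub_mul, mul_add, mul_add, hT2, (hcomm Y).eq]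
    rw [show opSqrt (D Y : E →L[ℝ] E) * (Y : E →L[ℝ] E) +
        ((Y : E →L[ℝ] E) * Y + (4 : ℝ) • (1 : E →L[ℝ] E))
      - ((Y : E →L[ℝ] E) * Y + opSqrt (D Y : E →L[ℝ] E) * (Y : E →L[ℝ] E)) =
        (4 : ℝ) • (1 : E →L[ℝ] E) by abel,
      smul_smul]
    norm_num
  have hGpos : ∀ Y, G Y ∈ posPart R := by
    intro Y
    refine isPosDef_of_add_inverse (G Y).2.2 (hkg Y) ?_
    have : (G Y : E →L[ℝ] E) + (1 / 2 : ℝ) • (opSqrt (D Y : E →L[ℝ] E) - (Y : E →L[ℝ] E)) =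
        opSqrt (D Y) := by
      rw [hG]
      module
    rw [this]
    exact isPosDef_opSqrt (hDpos Y)
  refine ⟨F, G, fun X hX => ?_, ?_, hGpos, fun Y => ?_, fun X hX => ?_⟩
  · refine ContDiffAt.contDiffWithinAt ?_
    obtain ⟨u, hu⟩ := (mem_posPart.1 hX).isUnit
    have hinv : ContDiffAt ℝ ω Ring.inverse (X : E →L[ℝ] E) := hu ▸ contDiffAt_ringInverse ℝ u
    exact P.contDiff.contDiffAt.comp X
      (hval.contDiffAt.sub (ContDiffAt.comp X hinv hval.contDiffAt))
  · have hDs : ContDiff ℝ ω D := P.contDiff.comp ((hval.mul hval).add contDiff_const)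
    have hS : ContDiff ℝ ω fun Y => symSqrt R (D Y) :=
      contDiffOn_univ.1 ((contDiffOn_symSqrt R).comp hDs.contDiffOn fun Y _ => hDpos Y)
    exact (contDiff_id.add hS).const_smul (1 / 2 : ℝ)
  · refine Subtype.ext ?_
    have hinv : Ring.inverse (G Y : E →L[ℝ] E) =
        (1 / 2 : ℝ) • (opSqrt (D Y : E →L[ℝ] E) - (Y : E →L[ℝ] E)) := by
      rw [← Ring.mul_inverse_cancel_right (G Y : E →L[ℝ] E)
        ((1 / 2 : ℝ) • (opSqrt (D Y : E →L[ℝ] E) - (Y : E →L[ℝ] E))) (hGpos Y).isUnit, hkg, one_mul]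
    rw [hF _ (hGpos Y), hinv, hG]
    module
  · refine Subtype.ext ?_
    have hu : IsUnit (X : E →L[ℝ] E) := (mem_posPart.1 hX).isUnit
    have hXi := Ring.mul_inverse_cancel (X : E →L[ℝ] E) hu
    have hiX := Ring.inverse_mul_cancel (X : E →L[ℝ] E) hu
    have hposi : IsPosDef (Ring.inverse (X : E →L[ℝ] E)) := by
      have h1 := (mem_posPart.1 hX).star_mul_mul (u := Ring.inverse (X : E →L[ℝ] E))
        hu.ringInverse
      rwa [X.2.2.ringInverse.star_eq, hiX, one_mul] at h1
    have hroot : opSqrt (D (F X) : E →L[ℝ] E) = X + Ring.inverse (X : E →L[ℝ] E) := by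
      refine opSqrt_eq_of_mul_self_eq ((mem_posPart.1 hX).add hposi) ?_
      rw [hD, hF X hX]
      simp only [add_mul, mul_add, sub_mul, mul_sub, hXi, hiX]
      module
    rw [hG, hroot, hF X hX]
    module

end Cone

/-! ### Manifolds with a global chart -/

section GlobalChart

variable {X : Type} [TopologicalSpace X] {d : ℕ}

/-- The charted space structure given by a single global chart. -/
@[reducible]
def globalChart (e : X ≃ₜ Euc d) : ChartedSpace (Euc d) X :=
  e.toOpenPartialHomeomorph.singletonChartedSpace rfl

lemma isManifold_globalChart (e : X ≃ₜ Euc d) :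
    @IsManifold _ _ _ _ _ _ _ (𝓡 d) ω X _ (globalChart e) :=
  e.toOpenPartialHomeomorph.isManifold_singleton rfl

lemma contMDiff_globalChart (e : X ≃ₜ Euc d) :
    letI := globalChart e
    ContMDiff (𝓡 d) (𝓡 d) ω e := by
  let := globalChart e
  have := isManifold_globalChart e
  intro x
  exact (contMDiffOn_chart (I := 𝓡 d) (n := ω) (x := x)).contMDiffAt Filter.univ_mem

lemma contMDiff_globalChart_symm (e : X ≃ₜ Euc d) :
    letI := globalChart e
    ContMDiff (𝓡 d) (𝓡 d) ω e.symm := by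
  let := globalChart e
  have := isManifold_globalChart e
  intro y
  exact (contMDiffOn_chart_symm (I := 𝓡 d) (n := ω) (x := e.symm y)).contMDiffAt Filter.univ_mem

/-- A global chart is a diffeomorphism. -/
def globalChartDiffeomorph (e : X ≃ₜ Euc d) :
    letI := globalChart e
    Diffeomorph (𝓡 d) (𝓡 d) X (Euc d) ω :=
  letI := globalChart e
  { toEquiv := e.toEquiv
    contMDiff_toFun := contMDiff_globalChart e
    contMDiff_invFun := contMDiff_globalChart_symm e }

/-- Read in the global charts, the map is the linear isomorphism `A`. -/
lemma contMDiff_pi_globalChart {ι : Type} [Fintype ι] {D : ι → ℕ} {Y : ι → Type}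
    [∀ i, TopologicalSpace (Y i)] (e : X ≃ₜ Euc d) (f : ∀ i, Y i ≃ₜ Euc (D i))
    (A : Euc d ≃L[ℝ] ∀ i, Euc (D i)) :
    letI := globalChart e
    letI := fun i => globalChart (f i)
    ContMDiff (𝓡 d) (ModelWithCorners.pi fun i => 𝓡 (D i)) ω
      (fun x i => (f i).symm (A (e x) i)) := by
  let := globalChart e
  let := fun i => globalChart (f i)
  intro x
  rw [contMDiffAt_iff]
  refine ⟨Continuous.continuousAt (continuous_pi fun i => (f i).symm.continuous.comp
    ((continuous_apply i).comp (A.continuous.comp e.continuous))), ?_⟩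
  refine (A.contDiff.contDiffWithinAt).congr_of_eventuallyEq (Filter.Eventually.of_forall ?_) ?_
  · intro y
    funext i
    change f i ((f i).symm (A (e (e.symm y)) i)) = A y i
    simp
  · funext i
    change f i ((f i).symm (A (e (e.symm (e x))) i)) = A (e x) i
    simp

lemma contMDiff_pi_globalChart_symm {ι : Type} [Fintype ι] {D : ι → ℕ} {Y : ι → Type}
    [∀ i, TopologicalSpace (Y i)] (e : X ≃ₜ Euc d) (f : ∀ i, Y i ≃ₜ Euc (D i))
    (A : Euc d ≃L[ℝ] ∀ i, Euc (D i)) :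
    letI := globalChart e
    letI := fun i => globalChart (f i)
    ContMDiff (ModelWithCorners.pi fun i => 𝓡 (D i)) (𝓡 d) ω
      (fun y : ∀ i, Y i => e.symm (A.symm fun i => f i (y i))) := by
  let := globalChart e
  let := fun i => globalChart (f i)
  intro y
  rw [contMDiffAt_iff]
  refine ⟨Continuous.continuousAt (e.symm.continuous.comp (A.symm.continuous.comp
    (continuous_pi fun i => (f i).continuous.comp (continuous_apply i)))), ?_⟩
  refine (A.symm.contDiff.contDiffWithinAt).congr_of_eventuallyEq
    (Filter.Eventually.of_forall ?_) ?_
  · intro z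
    change e (e.symm (A.symm fun i => f i ((f i).symm (z i)))) = A.symm z
    simp
  · change e (e.symm (A.symm fun i => f i ((f i).symm (f i (y i))))) = A.symm fun i => f i (y i)
    simp

/-- Manifolds `X` and `Y i` with global charts of dimensions `∑ i, D i` and `D i`: the space `X` is
diffeomorphic to the product of the `Y i`. -/
theorem nonempty_diffeomorph_pi {ι : Type} [Fintype ι] {D : ι → ℕ} {Y : ι → Type}
    [∀ i, TopologicalSpace (Y i)] (e : X ≃ₜ Euc d) (f : ∀ i, Y i ≃ₜ Euc (D i))
    (hd : d = ∑ i, D i) :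
    letI := globalChart e
    letI := fun i => globalChart (f i)
    Nonempty (Diffeomorph (𝓡 d) (ModelWithCorners.pi fun i => 𝓡 (D i)) X (∀ i, Y i) ω) := by
  let := globalChart e
  let := fun i => globalChart (f i)
  let A : Euc d ≃L[ℝ] ∀ i, Euc (D i) := ContinuousLinearEquiv.ofFinrankEq (by
    rw [Module.finrank_pi_fintype]; simp [hd])
  exact ⟨{
    toFun := fun x i => (f i).symm (A (e x) i)
    invFun := fun y => e.symm (A.symm fun i => f i (y i))
    left_inv := fun x => by simp
    right_inv := fun y => by simp
    contMDiff_toFun := contMDiff_pi_globalChart e f A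
    contMDiff_invFun := contMDiff_pi_globalChart_symm e f A }⟩

/-- A criterion for a quotient `p : P → X` of a subset `P` of a vector space `V` to be an analytic
quotient manifold with a global chart: its fibres are those of a map `q` onto an open subset `Ω` of
a vector space `W` that is analytically diffeomorphic to `W`, and `q` extends to an analytic map on
`V` and has analytic sections through all points of `P`. -/
theorem exists_globalChart_isAnalyticQuotient {P V W : Type} [TopologicalSpace P] [Nonempty P]
    [NormedAddCommGroup V] [NormedSpace ℝ V] [NormedAddCommGroup W] [NormedSpace ℝ W]
    [FiniteDimensional ℝ W] (hd : Module.finrank ℝ W = d) {ι : P → V} (hι : Topology.IsInducing ι)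
    {p : P → X} (hp : Topology.IsQuotientMap p) {Ω : Set W} (hΩ : IsOpen Ω)
    {q : P → W} (hqΩ : ∀ a, q a ∈ Ω) (hqp : ∀ a b, q a = q b ↔ p a = p b)
    {Q : V → W} (hQ : ContDiff ℝ ω Q) (hQq : ∀ a, Q (ι a) = q a)
    {σ : P → W → P} (hσ : ∀ a, σ a (q a) = a) (hqσ : ∀ a, ∀ w ∈ Ω, q (σ a w) = w)
    (hσω : ∀ a, ContDiffOn ℝ ω (fun w => ι (σ a w)) Ω)
    {F G : W → W} (hF : ContDiffOn ℝ ω F Ω) (hG : ContDiff ℝ ω G) (hGΩ : ∀ y, G y ∈ Ω)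
    (hFG : ∀ y, F (G y) = y) (hGF : ∀ x ∈ Ω, G (F x) = x) :
    ∃ e : X ≃ₜ Euc d, IsAnalyticQuotient (globalChart e) ι p := by
  let A : W ≃L[ℝ] Euc d := ContinuousLinearEquiv.ofFinrankEq (by simp [hd])
  obtain ⟨a₀⟩ := ‹Nonempty P›
  -- An arbitrary set-theoretic section suffices to define the chart, since `q` is constant on the
  -- fibres of `p`; continuity is checked after composing with the quotient map.
  let r : X → P := Function.surjInv hp.surjective
  have hr : ∀ x, p (r x) = x := Function.surjInv_eq hp.surjective
  have hqr : ∀ a, q (r (p a)) = q a := fun a => (hqp _ _).2 (hr _)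
  have hqc : Continuous q := by
    have : q = Q ∘ ι := funext fun a => (hQq a).symm
    rw [this]
    exact hQ.continuous.comp hι.continuous
  have hσc : ∀ a, ContinuousOn (σ a) Ω := fun a =>
    hι.continuousOn_iff.2 (hσω a).continuousOn
  let e : X ≃ₜ Euc d :=
    { toFun := fun x => A (F (q (r x)))
      invFun := fun y => p (σ a₀ (G (A.symm y)))
      left_inv := fun x => by
        simp only [ContinuousLinearEquiv.symm_apply_apply]
        rw [hGF _ (hqΩ _)]
        conv_rhs => rw [← hr x]
        exact (hqp _ _).1 (hqσ _ _ (hqΩ _))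
      right_inv := fun y => by
        simp only
        rw [hqr, hqσ _ _ (hGΩ _), hFG, ContinuousLinearEquiv.apply_symm_apply]
      continuous_toFun := by
        rw [hp.continuous_iff]
        have : (fun x => A (F (q (r x)))) ∘ p = fun a => A (F (q a)) :=
          funext fun a => by simp [hqr]
        rw [this]
        exact A.continuous.comp (hF.continuousOn.comp_continuous hqc hqΩ)
      continuous_invFun := hp.continuous.comp
        ((hσc a₀).comp_continuous (hG.continuous.comp A.symm.continuous) fun y => hGΩ _) }
  have hep : ∀ a, e (p a) = A (F (q a)) := fun a => by
    change A (F (q (r (p a)))) = _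
    rw [hqr]
  have hep' : ∀ a, e.symm (A (F (q a))) = p a := fun a => by
    rw [← hep, Homeomorph.symm_apply_apply]
  let := globalChart e
  refine ⟨e, isManifold_globalChart e, hp.surjective, fun a => ?_, fun a => ?_⟩
  · refine ⟨Q ⁻¹' Ω, hΩ.preimage hQ.continuous, ?_, fun v => e.symm (A (F (Q v))), ?_, ?_⟩
    · rw [Set.mem_preimage, hQq]
      exact hqΩ a
    · have h1 : ContDiffOn ℝ ω (fun v => A (F (Q v))) (Q ⁻¹' Ω) :=
        A.contDiff.comp_contDiffOn (hF.comp hQ.contDiffOn fun v hv => hv)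
      exact (contMDiff_globalChart_symm e).comp_contMDiffOn h1.contMDiffOn
    · intro b _
      beta_reduce
      rw [hQq, hep']
  · refine ⟨Set.univ, isOpen_univ, Set.mem_univ _, fun x => σ a (G (A.symm (e x))), ?_, ?_, ?_⟩
    · beta_reduce
      rw [hep, ContinuousLinearEquiv.symm_apply_apply, hGF _ (hqΩ a), hσ]
    · intro x _
      obtain ⟨b, rfl⟩ := hp.surjective x
      beta_reduce
      rw [hep, ContinuousLinearEquiv.symm_apply_apply, hGF _ (hqΩ b)]
      exact (hqp _ _).1 (hqσ _ _ (hqΩ _))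
    · have h1 : ContDiff ℝ ω (fun y => ι (σ a (G (A.symm y)))) :=
        contDiffOn_univ.1 ((hσω a).comp (hG.comp A.symm.contDiff).contDiffOn fun y _ => hGΩ _)
      exact (h1.contMDiff.comp (contMDiff_globalChart e)).contMDiffOn

end GlobalChart

/-! ### The analytic structure of Teichmüller space -/

lemma mem_unitarySubgroup_iff {R : Type} [Monoid R] [StarMul R] {u : Rˣ} :
    u ∈ unitarySubgroup R ↔ star (u : R) * u = 1 := by
  constructor
  · rintro ⟨v, rfl⟩
    exact Unitary.star_mul_self_of_mem v.2
  · intro h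
    have h' : star (u : R) = ((u⁻¹ : Rˣ) : R) := by
      rw [← mul_one (star (u : R)), ← u.mul_inv, ← mul_assoc, h, one_mul]
    exact ⟨⟨u, Unitary.mem_iff.2 ⟨h, by rw [h', u.mul_inv]⟩⟩, Units.ext rfl⟩

/-! ### Analytic solutions of `A* A = S` -/

section Sqrt

variable {E : Type*} [NormedAddCommGroup E] [InnerProductSpace ℝ E] [CompleteSpace E]
  [FiniteDimensional ℝ E]

/-- This is the analyticity of the square root for the algebra of all operators, with `f` retracted
onto the selfadjoint ones. -/
lemma contDiffOn_opSqrt_comp {X : Type*} [NormedAddCommGroup X] [NormedSpace ℝ X]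
    {f : X → E →L[ℝ] E} {s : Set X} (hf : ContDiffOn ℝ ω f s) (hpos : ∀ x ∈ s, IsPosDef (f x)) :
    ContDiffOn ℝ ω (fun x => opSqrt (f x)) s := by
  let R : StarSubalgebra ℝ (E →L[ℝ] E) := ⊤
  obtain ⟨P, hP⟩ := exists_continuousLinearMap_retraction (symPart R)
  have hPf : ∀ x ∈ s, (P (f x) : E →L[ℝ] E) = f x := fun x hx =>
    congrArg Subtype.val (hP ⟨f x, StarSubalgebra.mem_top, (hpos x hx).isSelfAdjoint⟩)
  have h1 : ContDiffOn ℝ ω (fun x => symSqrt R (P (f x))) s :=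
    (contDiffOn_symSqrt R).comp (P.contDiff.comp_contDiffOn hf) fun x hx => by
      rw [mem_posPart, hPf x hx]
      exact hpos x hx
  refine ((contDiff_coe_symPart R).comp_contDiffOn h1).congr fun x hx => ?_
  change opSqrt (f x) = opSqrt (P (f x) : E →L[ℝ] E)
  rw [hPf x hx]

lemma contDiff_star_op : ContDiff ℝ ω (fun A : E →L[ℝ] E => star A) := by
  have h : ContDiff ℝ ω (starL' ℝ : (E →L[ℝ] E) ≃L[ℝ] (E →L[ℝ] E)) :=
    ContinuousLinearEquiv.contDiff _
  exact h

lemma opSqrt_one : opSqrt (1 : E →L[ℝ] E) = 1 :=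
  opSqrt_eq_of_mul_self_eq
    ⟨IsSelfAdjoint.one _, fun _ hv => real_inner_self_pos.2 hv⟩ (one_mul 1)

/-- A solution `A` of the equation `A* A = S`, near the given `a` if `S` is near `a* a`. -/
def leftRoot (a : (E →L[ℝ] E)ˣ) (S : E →L[ℝ] E) : E →L[ℝ] E :=
  opSqrt (star (↑a⁻¹ : E →L[ℝ] E) * S * (↑a⁻¹ : E →L[ℝ] E)) * a

lemma star_units_mul_star_inv (a : (E →L[ℝ] E)ˣ) :
    star (a : E →L[ℝ] E) * star (↑a⁻¹ : E →L[ℝ] E) = 1 := by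
  rw [← star_mul, a.inv_mul, star_one]

lemma star_inv_mul_star_units (a : (E →L[ℝ] E)ˣ) :
    star (↑a⁻¹ : E →L[ℝ] E) * star (a : E →L[ℝ] E) = 1 := by
  rw [← star_mul, a.mul_inv, star_one]

lemma isUnit_leftRoot (a : (E →L[ℝ] E)ˣ) {S : E →L[ℝ] E} (hS : IsPosDef S) :
    IsUnit (leftRoot a S) :=
  (isPosDef_opSqrt (hS.star_mul_mul a⁻¹.isUnit)).isUnit.mul a.isUnit

lemma star_leftRoot_mul_leftRoot (a : (E →L[ℝ] E)ˣ) {S : E →L[ℝ] E} (hS : IsPosDef S) :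
    star (leftRoot a S) * leftRoot a S = S := by
  rw [leftRoot, star_mul, (isSelfAdjoint_opSqrt _).star_eq, mul_assoc,
    ← mul_assoc (opSqrt _) (opSqrt _), opSqrt_mul_self (hS.star_mul_mul a⁻¹.isUnit)]
  simp only [mul_assoc, Units.inv_mul, mul_one]
  rw [← mul_assoc, star_units_mul_star_inv, one_mul]

lemma leftRoot_star_mul_self (a : (E →L[ℝ] E)ˣ) :
    leftRoot a (star (a : E →L[ℝ] E) * a) = a := by
  rw [leftRoot, ← mul_assoc, star_inv_mul_star_units, one_mul, Units.mul_inv, opSqrt_one, one_mul]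

lemma contDiffOn_leftRoot (a : (E →L[ℝ] E)ˣ) : ContDiffOn ℝ ω (leftRoot a) {S | IsPosDef S} :=
  (contDiffOn_opSqrt_comp ((contDiff_const.mul contDiff_id).mul contDiff_const).contDiffOn
    fun _ hS => IsPosDef.star_mul_mul hS a⁻¹.isUnit).mul contDiffOn_const

end Sqrt

/-! ### Teichmüller space as the positive cone of the commutant -/

section Teich

variable {n : ℕ} (π : Subgroup (Iso n))

lemma star_mul_self_of_mem_holonomy {h : GLn n} (hh : h ∈ holonomy π) :
    star (h : Euc n →L[ℝ] Euc n) * h = 1 := by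
  obtain ⟨g, -, rfl⟩ := hh
  ext1 x
  refine ext_inner_right ℝ fun y => ?_
  rw [mul_apply_eq_comp, inner_star_apply]
  exact g.linearIsometryEquiv.inner_map_map x y

lemma star_eq_inv_of_mem_holonomy {h : GLn n} (hh : h ∈ holonomy π) :
    star (h : Euc n →L[ℝ] Euc n) = ((h⁻¹ : GLn n) : Euc n →L[ℝ] Euc n) := by
  rw [← mul_one (star (h : Euc n →L[ℝ] Euc n)), ← h.mul_inv, ← mul_assoc,
    star_mul_self_of_mem_holonomy π hh, one_mul]

/-- The algebra of operators that commute with the holonomy group. -/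
def holonomyCommutant : StarSubalgebra ℝ (Euc n →L[ℝ] Euc n) :=
  StarSubalgebra.centralizer ℝ ((fun h : GLn n => (h : Euc n →L[ℝ] Euc n)) '' holonomy π)

/-- The centralizer also asks for commutation with the adjoints; these are inverses of holonomy
elements, so nothing is added. -/
lemma mem_holonomyCommutant_iff {T : Euc n →L[ℝ] Euc n} :
    T ∈ holonomyCommutant π ↔
      ∀ h ∈ holonomy π, (h : Euc n →L[ℝ] Euc n) * T = T * (h : Euc n →L[ℝ] Euc n) := by
  rw [holonomyCommutant, StarSubalgebra.mem_centralizer_iff]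
  simp only [Set.forall_mem_image]
  refine ⟨fun H h hh => (H hh).1, fun H h hh => ⟨H h hh, ?_⟩⟩
  rw [star_eq_inv_of_mem_holonomy π hh]
  exact H _ (inv_mem hh)

/-- Put `B = A* A`. Since `h* = h⁻¹`, orthogonality of `A h A⁻¹` reads `h⁻¹ B h = B`. -/
lemma mem_cone_iff {A : GLn n} :
    A ∈ cone π ↔ star (A : Euc n →L[ℝ] Euc n) * A ∈ holonomyCommutant π := by
  rw [mem_holonomyCommutant_iff]
  refine forall₂_congr fun h hh => ?_
  rw [mem_unitarySubgroup_iff]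
  have hs := star_eq_inv_of_mem_holonomy π hh
  set B := star (A : Euc n →L[ℝ] Euc n) * A with hB
  have h1 : star ((A * h * A⁻¹ : GLn n) : Euc n →L[ℝ] Euc n) * ((A * h * A⁻¹ : GLn n))
      = star (↑A⁻¹ : Euc n →L[ℝ] Euc n) * (↑h⁻¹ * B * h) * ↑A⁻¹ := by
    simp only [Units.val_mul, star_mul, hs, hB, mul_assoc]
  rw [h1]
  constructor
  · intro H
    have h2 : (↑h⁻¹ : Euc n →L[ℝ] Euc n) * B * h = B := by
      have h3 := congrArg (fun T => star (A : Euc n →L[ℝ] Euc n) * T * A) H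
      simp only [mul_assoc, Units.inv_mul, mul_one] at h3
      rw [← mul_assoc, star_units_mul_star_inv, one_mul] at h3
      simpa only [mul_assoc] using h3
    conv_lhs => rw [← h2, mul_assoc, Units.mul_inv_cancel_left]
  · intro H
    rw [mul_assoc (↑h⁻¹ : Euc n →L[ℝ] Euc n), ← H, Units.inv_mul_cancel_left, hB, ← mul_assoc,
      star_inv_mul_star_units, one_mul, Units.mul_inv]

lemma isInducing_coneIncl : Topology.IsInducing (coneIncl π) := by
  have h1 : Topology.IsInducing (Units.val : GLn n → (Euc n →L[ℝ] Euc n)) :=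
    Units.isOpenEmbedding_val.isInducing
  exact h1.comp Topology.IsInducing.subtypeVal

/-- If `a* a = b* b`, then `a b⁻¹` is orthogonal and carries `b` to `a`. -/
lemma teichMk_eq_iff (a b : cone π) : teichMk π a = teichMk π b ↔
    star (coneIncl π a) * coneIncl π a = star (coneIncl π b) * coneIncl π b := by
  rw [teichMk, teichMk, Quotient.eq, MulAction.orbitRel_apply, MulAction.mem_orbit_iff]
  constructor
  · rintro ⟨u, rfl⟩
    have hu := mem_unitarySubgroup_iff.1 u.2
    change star (((u : GLn n) : Euc n →L[ℝ] Euc n) * coneIncl π b) *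
      (((u : GLn n) : Euc n →L[ℝ] Euc n) * coneIncl π b) = star (coneIncl π b) * coneIncl π b
    rw [star_mul, mul_assoc, ← mul_assoc (star _) _ (coneIncl π b), hu, one_mul]
  · intro h
    have h' : star ((a : GLn n) : Euc n →L[ℝ] Euc n) * (a : GLn n) =
        star ((b : GLn n) : Euc n →L[ℝ] Euc n) * (b : GLn n) := h
    have hu : (a : GLn n) * (b : GLn n)⁻¹ ∈ On n := by
      rw [mem_unitarySubgroup_iff, Units.val_mul, star_mul, mul_assoc, ← mul_assoc (star _) _
        (↑(b : GLn n)⁻¹ : Euc n →L[ℝ] Euc n), h', ← mul_assoc, ← mul_assoc,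
        star_inv_mul_star_units, one_mul, Units.mul_inv]
    refine ⟨⟨_, hu⟩, Subtype.ext ?_⟩
    change (a : GLn n) * (b : GLn n)⁻¹ * b = a
    group

/-- The space `O(n) \ C_π` is a real-analytic quotient manifold of `C_π` with a global chart: the
map `A ↦ A* A` identifies it with the cone of positive definite operators that commute with the
holonomy group. -/
theorem exists_globalChart_teich {d : ℕ}
    (hd : Module.finrank ℝ (symPart (holonomyCommutant π)) = d) :
    ∃ e : Teich π ≃ₜ Euc d, IsAnalyticQuotient (globalChart e) (coneIncl π) (teichMk π) := by
  classical
  let R := holonomyCommutant π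
  obtain ⟨P, hP⟩ := exists_continuousLinearMap_retraction (symPart R)
  obtain ⟨F, G, hF, hG, hGΩ, hFG, hGF⟩ := exists_analytic_equiv_posPart_symPart R
  have hunit : ∀ a : cone π, IsUnit (coneIncl π a) := fun a => (a : GLn n).isUnit
  let q : cone π → symPart R := fun a => ⟨star (coneIncl π a) * coneIncl π a,
    (mem_cone_iff π).1 a.2, IsSelfAdjoint.star_mul_self _⟩
  have hroot : ∀ (a : cone π) (S : symPart R), S ∈ posPart R →
      ∃ b : cone π, coneIncl π b = leftRoot (a : GLn n) S := by
    intro a S hS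
    obtain ⟨u, hu⟩ := isUnit_leftRoot (a : GLn n) hS
    refine ⟨⟨u, (mem_cone_iff π).2 ?_⟩, hu⟩
    rw [hu, star_leftRoot_mul_leftRoot _ hS]
    exact S.2.1
  -- The section through `a` sends `S` to `leftRoot a S`, which lies in the cone because its `A* A`
  -- is `S`. The value `a` outside the positive part is never used.
  let σ : cone π → symPart R → cone π := fun a S =>
    if hS : S ∈ posPart R then (hroot a S hS).choose else a
  have hσι : ∀ a, ∀ S ∈ posPart R, coneIncl π (σ a S) = leftRoot (a : GLn n) S := by
    intro a S hS
    simp only [σ, dif_pos hS]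
    exact (hroot a S hS).choose_spec
  have hinj : Function.Injective (coneIncl π) := fun a b h => Subtype.ext (Units.ext h)
  have hqΩ : ∀ a, q a ∈ posPart R := fun a => isPosDef_star_mul_self_of_isUnit (hunit a)
  have hne : Nonempty (cone π) := ⟨⟨1, (mem_cone_iff π).2 (by simp)⟩⟩
  refine exists_globalChart_isAnalyticQuotient (P := cone π) hd (ι := coneIncl π)
    (isInducing_coneIncl π)
    isQuotientMap_quotient_mk' (isOpen_posPart R) (q := q) hqΩ
    ?_ (Q := fun A => P (star A * A)) ?_ ?_ (σ := σ) ?_ ?_ ?_ hF hG hGΩ hFG hGF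
  · intro a b
    rw [teichMk_eq_iff]
    exact Subtype.ext_iff
  · exact P.contDiff.comp (contDiff_star_op.mul contDiff_id)
  · intro a
    exact hP (q a)
  · intro a
    refine hinj ((hσι a _ (hqΩ a)).trans ?_)
    exact leftRoot_star_mul_self (a : GLn n)
  · intro a S hS
    refine Subtype.ext ?_
    change star (coneIncl π (σ a S)) * coneIncl π (σ a S) = S
    rw [hσι a S hS, star_leftRoot_mul_leftRoot _ hS]
  · intro a
    exact ((contDiffOn_leftRoot (a : GLn n)).comp (contDiff_coe_symPart R).contDiffOn
      fun S hS => hS).congr fun S hS => hσι a S hS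

end Teich

/-! ### The dimension of a space of symmetric arrays -/

section SymmArray

variable {ι : Type*} {M : ι → ι → Type*} [∀ s t, AddCommGroup (M s t)] [∀ s t, Module ℝ (M s t)]

/-- The arrays that are symmetric with respect to given transposition maps. -/
def symmArray (τ : ∀ s t, M s t →ₗ[ℝ] M t s) : Submodule ℝ (∀ s t, M s t) where
  carrier := {f | ∀ s t, τ s t (f s t) = f t s}
  add_mem' hf hg s t := by simp [hf s t, hg s t]
  zero_mem' s t := by simp
  smul_mem' c f hf s t := by simp [hf s t]

/-- The symmetric elements of a diagonal entry. -/
def symmDiag (τ : ∀ s t, M s t →ₗ[ℝ] M t s) (s : ι) : Submodule ℝ (M s s) :=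
  LinearMap.eqLocus (τ s s) LinearMap.id

/-- The diagonal and the upper triangle of a symmetric array. -/
def symmArrayToUpper [LinearOrder ι] (τ : ∀ s t, M s t →ₗ[ℝ] M t s) :
    symmArray τ →ₗ[ℝ] (∀ s, symmDiag τ s) × (∀ p : {p : ι × ι // p.1 < p.2}, M p.1.1 p.1.2) where
  toFun f := (fun s => ⟨f.1 s s, f.2 s s⟩, fun p => f.1 p.1.1 p.1.2)
  map_add' _ _ := rfl
  map_smul' _ _ := rfl

lemma bijective_symmArrayToUpper [LinearOrder ι] {τ : ∀ s t, M s t →ₗ[ℝ] M t s}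
    (hτ : ∀ s t x, τ t s (τ s t x) = x) : Function.Bijective (symmArrayToUpper τ) := by
  constructor
  · intro f g hfg
    have h1 := congrArg Prod.fst hfg
    have h2 := congrArg Prod.snd hfg
    refine Subtype.ext (funext fun s => funext fun t => ?_)
    rcases lt_trichotomy s t with h | rfl | h
    · exact congrFun h2 ⟨(s, t), h⟩
    · exact congrArg Subtype.val (congrFun h1 s)
    · rw [← f.2 t s, ← g.2 t s]
      exact congrArg (τ t s) (congrFun h2 ⟨(t, s), h⟩)
  · rintro ⟨a, b⟩
    let f : ∀ s t, M s t := fun s t =>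
      if h : s < t then b ⟨(s, t), h⟩
      else if h : t < s then τ t s (b ⟨(t, s), h⟩)
      else if h : s = t then h ▸ (a s : M s s) else 0
    have hlt : ∀ s t (h : s < t), f s t = b ⟨(s, t), h⟩ := fun s t h => by simp [f, h]
    have hgt : ∀ s t (h : t < s), f s t = τ t s (b ⟨(t, s), h⟩) := fun s t h => by
      simp [f, h, h.not_gt]
    have heq : ∀ s, f s s = a s := fun s => by simp [f]
    refine ⟨⟨f, fun s t => ?_⟩, ?_⟩
    · rcases lt_trichotomy s t with h | rfl | h
      · rw [hlt s t h, hgt t s h]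
      · rw [heq]
        exact (a s).2
      · rw [hlt t s h, hgt s t h, hτ]
    · refine Prod.ext (funext fun s => Subtype.ext (heq s)) (funext fun p => ?_)
      exact hlt _ _ p.2

/-- A symmetric array is free on the diagonal and above it. Transposition matches the entries above
with those below, so twice the upper triangle is the whole off-diagonal sum; doubling avoids a
division. -/
theorem two_mul_finrank_symmArray [Fintype ι] [DecidableEq ι] [∀ s t, FiniteDimensional ℝ (M s t)]
    {τ : ∀ s t, M s t →ₗ[ℝ] M t s} (hτ : ∀ s t x, τ t s (τ s t x) = x)
    (hdiag : ∀ s, Module.finrank ℝ (symmDiag τ s) = 1) :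
    2 * Module.finrank ℝ (symmArray τ) =
      2 * Fintype.card ι + ∑ s, ∑ t, if s = t then 0 else Module.finrank ℝ (M s t) := by
  -- Any linear order serves to say which entries are above the diagonal.
  let : LinearOrder ι := LinearOrder.lift' (Fintype.equivFin ι) (Fintype.equivFin ι).injective
  rw [(LinearEquiv.ofBijective _ (bijective_symmArrayToUpper hτ)).finrank_eq,
    Module.finrank_prod, Module.finrank_pi_fintype, Module.finrank_pi_fintype]
  have hsymm : ∀ s t, Module.finrank ℝ (M s t) = Module.finrank ℝ (M t s) := fun s t =>
    (LinearEquiv.ofLinearMap (τ s t) (τ t s) (LinearMap.ext (hτ t s))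
      (LinearMap.ext (hτ s t))).finrank_eq
  have h1 : ∑ p : {p : ι × ι // p.1 < p.2}, Module.finrank ℝ (M p.1.1 p.1.2)
      = ∑ s, ∑ t, if s < t then Module.finrank ℝ (M s t) else 0 := by
    rw [← Fintype.sum_prod_type' (f := fun s t => if s < t then Module.finrank ℝ (M s t) else 0),
      ← Finset.sum_filter, ← Finset.sum_subtype_eq_sum_filter, Finset.subtype_univ]
  have h2 : ∑ s, ∑ t, (if s < t then Module.finrank ℝ (M s t) else 0)
      = ∑ s, ∑ t, if t < s then Module.finrank ℝ (M s t) else 0 := by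
    rw [Finset.sum_comm]
    simp only [hsymm]
  have h3 : ∑ s, ∑ t, (if s = t then 0 else Module.finrank ℝ (M s t))
      = (∑ s, ∑ t, if s < t then Module.finrank ℝ (M s t) else 0) +
        ∑ s, ∑ t, if t < s then Module.finrank ℝ (M s t) else 0 := by
    simp only [← Finset.sum_add_distrib]
    refine Finset.sum_congr rfl fun s _ => Finset.sum_congr rfl fun t _ => ?_
    rcases lt_trichotomy s t with h | rfl | h
    · simp [h, h.ne, h.not_gt]
    · simp
    · simp [h, h.ne', h.not_gt]
  rw [h3, ← h2, h1]
  simp only [hdiag, Finset.sum_const, Finset.card_univ, smul_eq_mul, mul_one]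
  ring

end SymmArray

/-! ### The algebras `ℝ`, `ℂ`, `ℍ` -/

namespace DivType

/-- The real part. -/
def re : (K : DivType) → K.Alg →ₗ[ℝ] ℝ
  | .real => (LinearMap.id : ℝ →ₗ[ℝ] ℝ)
  | .complex => Complex.reLm
  | .quaternionic => (QuaternionAlgebra.reₗ (-1) 0 (-1) : ℍ[ℝ] →ₗ[ℝ] ℝ)

/-- The real dimension. -/
def realDim : DivType → ℕ
  | .real => 1
  | .complex => 2
  | .quaternionic => 4

instance instStarModule : (K : DivType) → StarModule ℝ K.Alg
  | .real => inferInstanceAs (StarModule ℝ ℝ)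
  | .complex => inferInstanceAs (StarModule ℝ ℂ)
  | .quaternionic =>
    ⟨fun r x => (Quaternion.star_smul r (x : ℍ[ℝ])).trans (by rw [star_trivial]; rfl)⟩

instance instFiniteDimensional : (K : DivType) → FiniteDimensional ℝ K.Alg
  | .real => inferInstanceAs (FiniteDimensional ℝ ℝ)
  | .complex => inferInstanceAs (FiniteDimensional ℝ ℂ)
  | .quaternionic => inferInstanceAs (FiniteDimensional ℝ ℍ[ℝ])

lemma finrank_alg : ∀ K : DivType, Module.finrank ℝ K.Alg = K.realDim
  | .real => Module.finrank_self ℝ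
  | .complex => Complex.finrank_real_complex
  | .quaternionic => Quaternion.finrank_eq_four

lemma re_star : ∀ (K : DivType) (x : K.Alg), K.re (star x) = K.re x
  | .real, _ => rfl
  | .complex, x => Complex.conj_re x
  | .quaternionic, x => Quaternion.re_star x

lemma re_star_mul_self : ∀ (K : DivType) (x : K.Alg), K.re (star x * x) = ‖x‖ ^ 2
  | .real, x => by
    have key : ∀ y : ℝ, y * y = ‖y‖ ^ 2 := fun y => by rw [Real.norm_eq_abs, sq_abs, sq]
    exact key x
  | .complex, x => by
    have key : ∀ y : ℂ, (star y * y).re = ‖y‖ ^ 2 := fun y => by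
      rw [← Complex.normSq_eq_norm_sq, Complex.normSq_apply]
      simp
    exact key x
  | .quaternionic, x => by
    have key : ∀ y : ℍ[ℝ], (star y * y).re = ‖y‖ ^ 2 := fun y => by
      rw [Quaternion.star_mul_self, Quaternion.re_coe, Quaternion.normSq_eq_norm_mul_self, sq]
    exact key x

lemma eq_smul_one_of_star_eq : ∀ (K : DivType) (x : K.Alg), star x = x → x = K.re x • 1
  | .real, x, _ => (mul_one (x : ℝ)).symm
  | .complex, x, h => by
    have key : ∀ y : ℂ, star y = y → y = y.re • (1 : ℂ) := fun y hy => by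
      rw [Complex.real_smul, mul_one, Complex.conj_eq_iff_re.1 hy]
    exact key x h
  | .quaternionic, x, h => by
    have key : ∀ y : ℍ[ℝ], star y = y → y = y.re • (1 : ℍ[ℝ]) := fun y hy => by
      conv_lhs => rw [Quaternion.star_eq_self.1 hy]
      rw [← Quaternion.coe_one, Quaternion.smul_coe, mul_one]
    exact key x h

end DivType

/-- The inner product `Re (x* y)`. -/
@[reducible]
def DivType.innerProductSpace (K : DivType) : InnerProductSpace ℝ K.Alg where
  inner x y := K.re (star x * y)
  norm_sq_eq_re_inner x := (K.re_star_mul_self x).symm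
  conj_inner_symm x y := by
    change K.re (star y * x) = K.re (star x * y)
    rw [← K.re_star, star_mul, star_star]
  add_left x y z := by rw [star_add, add_mul, map_add]
  smul_left x y r := by
    rw [star_smul, smul_mul_assoc, map_smul]
    rfl

attribute [local instance] DivType.innerProductSpace

lemma DivType.inner_def (K : DivType) (x y : K.Alg) : inner ℝ x y = K.re (star x * y) := rfl

lemma DivType.inner_mul_left (K : DivType) (a x y : K.Alg) :
    inner ℝ (a * x) y = inner ℝ x (star a * y) := by
  simp only [DivType.inner_def, star_mul, mul_assoc]

/-! ### Matrices over `ℝ`, `ℂ`, `ℍ` as operators -/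

section Matrices

variable (m : ℕ) (K : DivType)

/-- The space `𝕂ᵐ` with its real inner product. -/
abbrev KVec : Type := PiLp 2 fun _ : Fin m => K.Alg

/-- The action of matrices on column vectors. -/
def matrixOp : Matrix (Fin m) (Fin m) K.Alg →ₐ[ℝ] (KVec m K →L[ℝ] KVec m K) :=
  AlgHom.ofLinearMap
    { toFun := fun A => LinearMap.toContinuousLinearMap
        { toFun := fun x => WithLp.toLp 2 (A.mulVec x.ofLp)
          map_add' := fun x y => by simp [Matrix.mulVec_add]
          map_smul' := fun c x => by simp [Matrix.mulVec_smul] }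
      map_add' := fun A B => by ext1 x; simp [Matrix.add_mulVec]
      map_smul' := fun c A => by ext1 x; simp [Matrix.smul_mulVec] }
    (by ext1 x; simp)
    (fun A B => by ext1 x; simp [Matrix.mulVec_mulVec])

lemma matrixOp_apply (A : Matrix (Fin m) (Fin m) K.Alg) (x : KVec m K) (i : Fin m) :
    matrixOp m K A x i = ∑ j, A i j * x j := rfl

lemma matrixOp_injective : Function.Injective (matrixOp m K) := by
  intro A B h
  ext i j
  have h1 := congrArg (fun T : KVec m K →L[ℝ] KVec m K => T (WithLp.toLp 2 (Pi.single j 1)) i) h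
  simpa [matrixOp_apply, Pi.single_apply] using h1

/-- For the inner product `Re (x* y)` on `𝕂`, the adjoint of left multiplication by an entry is left
multiplication by its conjugate. -/
lemma matrixOp_star (A : Matrix (Fin m) (Fin m) K.Alg) :
    matrixOp m K (star A) = star (matrixOp m K A) := by
  ext1 x
  refine ext_inner_right ℝ fun y => ?_
  rw [inner_star_apply]
  simp only [PiLp.inner_apply, matrixOp_apply, sum_inner, inner_sum]
  rw [Finset.sum_comm]
  refine Finset.sum_congr rfl fun i _ => Finset.sum_congr rfl fun j _ => ?_
  rw [DivType.inner_mul_left, Matrix.star_apply, star_star]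

/-- The star-algebra of operators on `𝕂ᵐ` given by matrices. -/
def matrixAlg : StarSubalgebra ℝ (KVec m K →L[ℝ] KVec m K) where
  toSubalgebra := (matrixOp m K).range
  star_mem' := by
    rintro _ ⟨A, rfl⟩
    exact ⟨star A, matrixOp_star m K A⟩

lemma mem_matrixAlg_iff {T : KVec m K →L[ℝ] KVec m K} :
    T ∈ matrixAlg m K ↔ ∃ A, matrixOp m K A = T := Iff.rfl

/-! ### The dimension of the space of Hermitian matrices -/

/-- Conjugation on the entries of square arrays. -/
def conjEntry (_ _ : Fin m) : K.Alg →ₗ[ℝ] K.Alg where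
  toFun x := star x
  map_add' := star_add
  map_smul' c x := by rw [star_smul, star_trivial]; rfl

lemma finrank_symmDiag_conjEntry (s : Fin m) :
    Module.finrank ℝ (symmDiag (conjEntry m K) s) = 1 := by
  refine finrank_eq_one (⟨1, star_one _⟩ : symmDiag (conjEntry m K) s) ?_ fun x => ?_
  · intro h
    exact one_ne_zero (congrArg Subtype.val h)
  · exact ⟨K.re x, Subtype.ext (K.eq_smul_one_of_star_eq x x.2).symm⟩

/-- This puts the three formulas into the common shape of the array count: `m` real diagonal entries
and `m (m - 1)` off-diagonal ones. The case `m = 0` is separate because of truncated subtraction. -/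
lemma two_mul_homDim : 2 * homDim m K = 2 * m + m * (m - 1) * K.realDim := by
  cases K
  · change 2 * (m * (m + 1) / 2) = 2 * m + m * (m - 1) * 1
    rw [Nat.mul_div_cancel' (Nat.even_mul_succ_self m).two_dvd]
    cases m
    · rfl
    · simp only [Nat.add_sub_cancel]; ring
  · change 2 * m ^ 2 = 2 * m + m * (m - 1) * 2
    cases m
    · rfl
    · simp only [Nat.add_sub_cancel]; ring
  · change 2 * (m * (2 * m - 1)) = 2 * m + m * (m - 1) * 4
    cases m with
    | zero => rfl
    | succ k =>
      rw [show 2 * (k + 1) - 1 = 2 * k + 1 by omega, Nat.add_sub_cancel]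
      ring

lemma finrank_symmArray_conjEntry :
    Module.finrank ℝ (symmArray (conjEntry m K)) = homDim m K := by
  have h := two_mul_finrank_symmArray (τ := conjEntry m K) (fun _ _ x => star_star x)
    (finrank_symmDiag_conjEntry m K)
  have h2 : ∑ s : Fin m, ∑ t : Fin m, (if s = t then 0 else Module.finrank ℝ K.Alg)
      = m * (m - 1) * K.realDim := by
    have : ∀ s : Fin m, ∑ t : Fin m, (if s = t then 0 else Module.finrank ℝ K.Alg)
        = (m - 1) * K.realDim := fun s => by
      rw [Finset.sum_ite, Finset.sum_const_zero, zero_add, Finset.sum_const, K.finrank_alg,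
        smul_eq_mul, Finset.filter_ne, Finset.card_erase_of_mem (Finset.mem_univ s),
        Finset.card_univ, Fintype.card_fin]
    simp only [this, Finset.sum_const, Finset.card_univ, Fintype.card_fin, smul_eq_mul, mul_assoc]
  rw [h2, Fintype.card_fin, ← two_mul_homDim] at h
  omega

/-- Hermitian matrices are the selfadjoint elements of the algebra of matrices. -/
def hermitianEquiv : symmArray (conjEntry m K) ≃ₗ[ℝ] symPart (matrixAlg m K) :=
  LinearEquiv.ofBijective
    (LinearMap.codRestrict (symPart (matrixAlg m K))
      ((matrixOp m K).toLinearMap ∘ₗ (Matrix.ofLinearEquiv ℝ).toLinearMap ∘ₗ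
        (symmArray (conjEntry m K)).subtype)
      fun f => ⟨⟨_, rfl⟩, by
        change star (matrixOp m K (Matrix.of f.1)) = _
        rw [← matrixOp_star]
        exact congrArg (matrixOp m K) (Matrix.ext fun i j => f.2 j i)⟩)
    (by
      constructor
      · intro f g h
        exact Subtype.ext (matrixOp_injective m K (congrArg Subtype.val h))
      · rintro ⟨_, ⟨A, rfl⟩, hA⟩
        refine ⟨⟨A, fun i j => ?_⟩, rfl⟩
        have h1 : star A = A := matrixOp_injective m K ((matrixOp_star m K A).trans hA)
        exact congrFun (congrFun h1 j) i)

lemma finrank_symPart_matrixAlg :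
    Module.finrank ℝ (symPart (matrixAlg m K)) = homDim m K := by
  rw [← (hermitianEquiv m K).finrank_eq, finrank_symmArray_conjEntry]

end Matrices

/-! ### The analytic structure of `GL(m, 𝕂) / O(m, 𝕂)` -/

lemma mem_unitarySubgroup_iff_mul_star {R : Type} [Monoid R] [StarMul R] {u : Rˣ} :
    u ∈ unitarySubgroup R ↔ (u : R) * star (u : R) = 1 := by
  constructor
  · rintro ⟨v, rfl⟩
    exact Unitary.mul_star_self_of_mem v.2
  · intro h
    have h' : star (u : R) = ((u⁻¹ : Rˣ) : R) := by
      rw [← one_mul (star (u : R)), ← u.inv_mul, mul_assoc, h, mul_one]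
    rw [mem_unitarySubgroup_iff, h', u.inv_mul]

/-- For left cosets the unitary factor stands on the right, so the invariant is `a a*` instead of
`a* a`. -/
lemma inv_mul_mem_unitarySubgroup_iff {R : Type} [Monoid R] [StarMul R] {a b : Rˣ} :
    a⁻¹ * b ∈ unitarySubgroup R ↔ (a : R) * star (a : R) = b * star (b : R) := by
  have h1 : star (↑a⁻¹ : R) * star (a : R) = 1 := by rw [← star_mul, a.mul_inv, star_one]
  have h2 : star (a : R) * star (↑a⁻¹ : R) = 1 := by rw [← star_mul, a.inv_mul, star_one]
  rw [mem_unitarySubgroup_iff_mul_star, Units.val_mul, star_mul]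
  constructor
  · intro h
    have h3 := congrArg (fun x => (a : R) * x * star (a : R)) h
    simp only [mul_one, mul_assoc, h1, Units.mul_inv_cancel_left] at h3
    exact h3.symm
  · intro h
    rw [mul_assoc, ← mul_assoc (b : R), ← h, mul_assoc (a : R), h2, mul_one, a.inv_mul]

section Sqrt

variable {E : Type*} [NormedAddCommGroup E] [InnerProductSpace ℝ E] [CompleteSpace E]
  [FiniteDimensional ℝ E]

lemma leftRoot_mem {R : StarSubalgebra ℝ (E →L[ℝ] E)} {a : (E →L[ℝ] E)ˣ} {S : E →L[ℝ] E}
    (ha : (a : E →L[ℝ] E) ∈ R) (ha' : (↑a⁻¹ : E →L[ℝ] E) ∈ R) (hS : S ∈ R) :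
    leftRoot a S ∈ R :=
  mul_mem (opSqrt_mem (mul_mem (mul_mem (star_mem ha') hS) ha')) ha

lemma continuousAt_ringInverse {T : E →L[ℝ] E} (hT : IsUnit T) : ContinuousAt Ring.inverse T := by
  obtain ⟨u, rfl⟩ := hT
  exact (contDiffAt_ringInverse ℝ (n := ω) u).continuousAt

lemma contDiff_mul_star_comp {V W : Type*} [NormedAddCommGroup V] [NormedSpace ℝ V]
    [NormedAddCommGroup W] [NormedSpace ℝ W] (f : V →L[ℝ] E →L[ℝ] E) (P : (E →L[ℝ] E) →L[ℝ] W) :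
    ContDiff ℝ ω (fun v => P (f v * star (f v))) :=
  P.contDiff.comp (f.contDiff.mul (contDiff_star_op.comp f.contDiff))

lemma contDiffOn_star_leftRoot_comp {W : Type*} [NormedAddCommGroup W] [NormedSpace ℝ W]
    (R : StarSubalgebra ℝ (E →L[ℝ] E)) (r : (E →L[ℝ] E) →L[ℝ] W) (a : (E →L[ℝ] E)ˣ) :
    ContDiffOn ℝ ω (fun S : symPart R => r (star (leftRoot a S))) (posPart R) :=
  r.contDiff.comp_contDiffOn (contDiff_star_op.comp_contDiffOn
    ((contDiffOn_leftRoot a).comp (contDiff_coe_symPart R).contDiffOn fun _ hS => hS))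

end Sqrt

/-! ### Unit groups of star-algebras modulo unitary elements -/

section UnitsQuotient

variable {E : Type} [NormedAddCommGroup E] [InnerProductSpace ℝ E] [CompleteSpace E]
  [FiniteDimensional ℝ E] {M : Type} [Monoid M] [StarMul M]

/-- The inverse operator also lies in `R`, so it comes from `M`, and injectivity of `ρ` makes the
preimages mutually inverse. -/
lemma exists_units_map_eq {R : StarSubalgebra ℝ (E →L[ℝ] E)} {ρ : M →* (E →L[ℝ] E)}
    (hρ : Function.Injective ρ) (hR : ∀ T, T ∈ R ↔ ∃ A, ρ A = T) {T : E →L[ℝ] E} (hT : T ∈ R)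
    (hu : IsUnit T) : ∃ A : Mˣ, ρ A = T := by
  obtain ⟨B, hB⟩ := (hR _).1 (ringInverse_mem hT hu)
  obtain ⟨A, rfl⟩ := (hR _).1 hT
  refine ⟨⟨A, B, hρ ?_, hρ ?_⟩, rfl⟩
  · rw [map_mul, hB, map_one, Ring.mul_inverse_cancel _ hu]
  · rw [map_mul, hB, map_one, Ring.inverse_mul_cancel _ hu]

/-- Let `M` be isomorphic to a star-algebra `R` of operators. The quotient of the group of units of
`M` by the unitary subgroup is a real-analytic quotient manifold with a global chart: the map
`A ↦ A A*` identifies it with the positive cone of `R`. -/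
theorem exists_globalChart_units_quotient [TopologicalSpace M] {V : Type} [NormedAddCommGroup V]
    [NormedSpace ℝ V] {d : ℕ} {R : StarSubalgebra ℝ (E →L[ℝ] E)}
    (hd : Module.finrank ℝ (symPart R) = d) {ρ : M →* (E →L[ℝ] E)} (hρ : Function.Injective ρ)
    (hstar : ∀ A, ρ (star A) = star (ρ A)) (hR : ∀ T, T ∈ R ↔ ∃ A, ρ A = T)
    {ι : Mˣ → V} (hι : Topology.IsInducing ι) (θ : V →L[ℝ] (E →L[ℝ] E))
    (hθ : ∀ a, θ (ι a) = ρ a) (r : (E →L[ℝ] E) →L[ℝ] V) (hr : ∀ a : Mˣ, r (ρ a) = ι a) :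
    ∃ e : (Mˣ ⧸ unitarySubgroup M) ≃ₜ Euc d,
      IsAnalyticQuotient (globalChart e) ι (QuotientGroup.mk : Mˣ → Mˣ ⧸ unitarySubgroup M) := by
  classical
  -- Taking adjoints turns `A A* = S` into the equation solved by `leftRoot`, based at `(ρ a)*`; the
  -- section is the adjoint of that solution.
  let ρu : Mˣ → (E →L[ℝ] E)ˣ := fun A => star (Units.map ρ A)
  have hρmem : ∀ A, ρ A ∈ R := fun A => (hR _).2 ⟨A, rfl⟩
  obtain ⟨P, hP⟩ := exists_continuousLinearMap_retraction (symPart R)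
  obtain ⟨F, G, hF, hG, hGΩ, hFG, hGF⟩ := exists_analytic_equiv_posPart_symPart R
  let q : Mˣ → symPart R := fun a => ⟨ρ a * star (ρ a),
    mul_mem (hρmem a) (star_mem (hρmem a)), IsSelfAdjoint.mul_star_self _⟩
  have hroot : ∀ (a : Mˣ) (S : symPart R), S ∈ posPart R →
      ∃ b : Mˣ, ρ b = star (leftRoot (ρu a) S) := fun a S hS =>
    exists_units_map_eq hρ hR
      (star_mem (leftRoot_mem (star_mem (hρmem a)) (star_mem (hρmem (↑a⁻¹ : M))) S.2.1))
      (isUnit_leftRoot _ hS).star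
  let σ : Mˣ → symPart R → Mˣ := fun a S =>
    if hS : S ∈ posPart R then (hroot a S hS).choose else a
  have hσρ : ∀ a, ∀ S ∈ posPart R, ρ (σ a S) = star (leftRoot (ρu a) S) := by
    intro a S hS
    simp only [σ, dif_pos hS]
    exact (hroot a S hS).choose_spec
  have hqΩ : ∀ a, q a ∈ posPart R := fun a =>
    isPosDef_self_mul_star_of_isUnit (a.isUnit.map ρ)
  refine exists_globalChart_isAnalyticQuotient hd hι isQuotientMap_quotient_mk'
    (isOpen_posPart R) (q := q) hqΩ
    ?_ (contDiff_mul_star_comp θ P) (fun a => ?_) (σ := σ) ?_ ?_ ?_ hF hG hGΩ hFG hGF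
  · intro a b
    rw [QuotientGroup.eq, inv_mul_mem_unitarySubgroup_iff, ← hρ.eq_iff, map_mul, map_mul,
      hstar, hstar]
    exact Subtype.ext_iff
  · rw [hθ]
    exact hP (q a)
  · intro a
    refine Units.ext (hρ ((hσρ a _ (hqΩ a)).trans ?_))
    have h1 := leftRoot_star_mul_self (ρu a)
    rw [show ((ρu a : (E →L[ℝ] E)ˣ) : E →L[ℝ] E) = star (ρ a) from rfl, star_star] at h1
    rw [h1, star_star]
  · intro a S hS
    refine Subtype.ext ?_
    change ρ (σ a S) * star (ρ (σ a S)) = S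
    rw [hσρ a S hS, star_star, star_leftRoot_mul_leftRoot _ hS]
  · intro a
    refine (contDiffOn_star_leftRoot_comp R r (ρu a)).congr fun S hS => ?_
    rw [← hσρ a S hS, hr]

end UnitsQuotient

section HomSpace

variable (m : ℕ) (K : DivType)

/-- The action of square arrays on column vectors, as a continuous linear map. -/
def arrayOp : (Fin m → Fin m → K.Alg) →L[ℝ] (KVec m K →L[ℝ] KVec m K) :=
  LinearMap.toContinuousLinearMap
    ((matrixOp m K).toLinearMap ∘ₗ (Matrix.ofLinearEquiv ℝ).toLinearMap)

lemma arrayOp_glIncl (A : GL (Fin m) K.Alg) :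
    arrayOp m K (glIncl m K A) = matrixOp m K (A : Matrix (Fin m) (Fin m) K.Alg) := rfl

lemma exists_leftInverse_arrayOp :
    ∃ r : (KVec m K →L[ℝ] KVec m K) →L[ℝ] (Fin m → Fin m → K.Alg), ∀ v, r (arrayOp m K v) = v := by
  have hker : LinearMap.ker ((matrixOp m K).toLinearMap ∘ₗ (Matrix.ofLinearEquiv ℝ).toLinearMap)
      = ⊥ := LinearMap.ker_eq_bot.2 (matrixOp_injective m K)
  obtain ⟨r, hr⟩ := LinearMap.exists_leftInverse_of_injective _ hker
  exact ⟨LinearMap.toContinuousLinearMap r, fun v => LinearMap.congr_fun hr v⟩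

/-- The topology on units also involves the inverse, so the point is continuity of matrix inversion;
it is inherited from inversion of operators on `𝕂ᵐ`. -/
lemma isInducing_glIncl : Topology.IsInducing (glIncl m K) := by
  obtain ⟨r, hr⟩ := exists_leftInverse_arrayOp m K
  let f : Matrix (Fin m) (Fin m) K.Alg → Matrix (Fin m) (Fin m) K.Alg := fun A =>
    Matrix.of (r (Ring.inverse (matrixOp m K A)))
  have hf : ContinuousOn f {A | IsUnit A} := by
    intro A hA
    refine ContinuousAt.continuousWithinAt ?_
    have h1 : ContinuousAt Ring.inverse (matrixOp m K A) :=
      continuousAt_ringInverse (hA.map (matrixOp m K))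
    have h2 : ContinuousAt (fun B : Matrix (Fin m) (Fin m) K.Alg => matrixOp m K B) A :=
      (arrayOp m K).continuous.continuousAt
    exact r.continuous.continuousAt.comp (ContinuousAt.comp h1 h2)
  have h := Units.isEmbedding_val_mk' hf fun u => by
    have h1 : Ring.inverse (matrixOp m K (u : Matrix (Fin m) (Fin m) K.Alg))
        = matrixOp m K (↑u⁻¹ : Matrix (Fin m) (Fin m) K.Alg) :=
      Ring.inverse_unit (Units.map (MonoidHomClass.toMonoidHom (matrixOp m K)) u)
    change Matrix.of (r (Ring.inverse (matrixOp m K (u : Matrix (Fin m) (Fin m) K.Alg)))) = _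
    rw [h1]
    exact hr _
  exact h.isInducing

/-- The space `GL(m, 𝕂) / O(m, 𝕂)` is a real-analytic quotient manifold of `GL(m, 𝕂)` with a global
chart. -/
theorem exists_globalChart_homSpace :
    ∃ e : HomSpace m K ≃ₜ Euc (homDim m K),
      IsAnalyticQuotient (globalChart e) (glIncl m K) (homMk m K) := by
  obtain ⟨r, hr⟩ := exists_leftInverse_arrayOp m K
  exact exists_globalChart_units_quotient (finrank_symPart_matrixAlg m K)
    (ρ := MonoidHomClass.toMonoidHom (matrixOp m K)) (matrixOp_injective m K) (matrixOp_star m K)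
    (fun T => mem_matrixAlg_iff m K) (isInducing_glIncl m K) (arrayOp m K)
    (arrayOp_glIncl m K) r fun a => hr (glIncl m K a)

end HomSpace

/-! ### Equivariant maps between orthogonal representations -/

section Orthogonal

variable {G U W : Type*} [Group G] [NormedAddCommGroup U] [InnerProductSpace ℝ U]
  [FiniteDimensional ℝ U] [NormedAddCommGroup W] [InnerProductSpace ℝ W] [FiniteDimensional ℝ W]

/-- A representation by orthogonal maps. -/
def IsOrthogonalRep (σ : Representation ℝ G U) : Prop :=
  ∀ g x y, inner ℝ (σ g x) (σ g y) = inner ℝ x y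

lemma rep_apply_inv_apply (σ : Representation ℝ G U) (g : G) (x : U) : σ g (σ g⁻¹ x) = x := by
  rw [← Module.End.mul_apply, ← map_mul, mul_inv_cancel, map_one, Module.End.one_apply]

lemma IsOrthogonalRep.inner_apply_left {σ : Representation ℝ G U} (hσ : IsOrthogonalRep σ) (g : G)
    (x y : U) : inner ℝ (σ g x) y = inner ℝ x (σ g⁻¹ y) := by
  rw [← hσ g x, rep_apply_inv_apply]

lemma isIntertwining_adjoint {σ : Representation ℝ G U} {τ : Representation ℝ G W}
    (hσ : IsOrthogonalRep σ) (hτ : IsOrthogonalRep τ) {T : U →ₗ[ℝ] W}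
    (hT : ∀ g x, T (σ g x) = τ g (T x)) (g : G) (y : W) :
    LinearMap.adjoint T (τ g y) = σ g (LinearMap.adjoint T y) := by
  refine ext_inner_right ℝ fun x => ?_
  rw [LinearMap.adjoint_inner_left, hσ.inner_apply_left, LinearMap.adjoint_inner_left, hT,
    hτ.inner_apply_left]

/-- The adjoint of an equivariant map. -/
def intertwiningAdjoint {σ : Representation ℝ G U} {τ : Representation ℝ G W}
    (hσ : IsOrthogonalRep σ) (hτ : IsOrthogonalRep τ) :
    σ.IntertwiningMap τ →ₗ[ℝ] τ.IntertwiningMap σ where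
  toFun T := ⟨LinearMap.adjoint T.toLinearMap, fun g => LinearMap.ext fun y =>
    isIntertwining_adjoint hσ hτ (Representation.IntertwiningMap.isIntertwining _ _ T) g y⟩
  map_add' S T := by
    apply Representation.IntertwiningMap.ext
    simp
  map_smul' c T := by
    apply Representation.IntertwiningMap.ext
    simp

lemma intertwiningAdjoint_inner_left {σ : Representation ℝ G U} {τ : Representation ℝ G W}
    (hσ : IsOrthogonalRep σ) (hτ : IsOrthogonalRep τ) (T : σ.IntertwiningMap τ) (x : U) (y : W) :
    inner ℝ (intertwiningAdjoint hσ hτ T y) x = inner ℝ y (T x) :=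
  LinearMap.adjoint_inner_left _ _ _

lemma intertwiningAdjoint_intertwiningAdjoint {σ : Representation ℝ G U}
    {τ : Representation ℝ G W} (hσ : IsOrthogonalRep σ) (hτ : IsOrthogonalRep τ)
    (T : σ.IntertwiningMap τ) :
    intertwiningAdjoint hτ hσ (intertwiningAdjoint hσ hτ T) = T :=
  Representation.IntertwiningMap.ext (LinearMap.adjoint_adjoint T.toLinearMap)

lemma nontrivial_of_isIrreducible (σ : Representation ℝ G U) [σ.IsIrreducible] : Nontrivial U := by
  by_contra h
  rw [not_nontrivial_iff_subsingleton] at h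
  obtain ⟨x, y, hxy⟩ := exists_pair_ne (Subrepresentation σ)
  exact hxy (SetLike.ext fun v => by
    rw [Subsingleton.elim v 0]
    exact ⟨fun _ => y.toSubmodule.zero_mem, fun _ => x.toSubmodule.zero_mem⟩)

/-- A selfadjoint equivariant endomorphism of an irreducible representation is a scalar. -/
lemma exists_eq_smul_one_of_isSymmetric {σ : Representation ℝ G U}
    [σ.IsIrreducible] (T : σ.IntertwiningMap σ) (hT : T.toLinearMap.IsSymmetric) :
    ∃ c : ℝ, T = c • 1 := by
  have := nontrivial_of_isIrreducible σ
  -- The supremum `c` of the Rayleigh quotient is an eigenvalue. Then `T - c` is equivariant and not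
  -- injective, so it is zero by Schur's lemma.
  have hc := hT.hasEigenvalue_iSup_of_finiteDimensional
  obtain ⟨v, hv⟩ := hc.exists_hasEigenvector
  set c : ℝ := ⨆ x : { x : U // x ≠ 0 },
    RCLike.re (inner ℝ (T.toLinearMap x) (x : U)) / ‖(x : U)‖ ^ 2 with hcdef
  refine ⟨c, ?_⟩
  have h0 : (T - c • 1) v = 0 := by
    have h1 : T v = c • v := hv.apply_eq_smul
    simp [h1]
  rcases Representation.IsIrreducible.injective_or_eq_zero (T - c • 1) with h | h
  · exact absurd (h (h0.trans (map_zero _).symm)) hv.2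
  · exact sub_eq_zero.1 h

lemma isSymmetric_of_intertwiningAdjoint_eq {σ : Representation ℝ G U} (hσ : IsOrthogonalRep σ)
    {T : σ.IntertwiningMap σ} (hT : intertwiningAdjoint hσ hσ T = T) :
    T.toLinearMap.IsSymmetric := fun x y => by
  have h := intertwiningAdjoint_inner_left hσ hσ T y x
  rw [hT] at h
  exact h

end Orthogonal

/-! ### Real algebras with a positive involution whose symmetric elements are scalars -/

section Frobenius

variable {D : Type*} [Ring D] [Algebra ℝ D] {s : D →ₗ[ℝ] D}

lemma exists_skew_sq_eq_neg_one (hpos : ∀ x, x ≠ 0 → ∃ c : ℝ, 0 < c ∧ s x * x = c • 1) {x : D}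
    (hx : x ≠ 0) (hsx : s x = -x) : ∃ r : ℝ, r ≠ 0 ∧ (r • x) * (r • x) = -1 := by
  obtain ⟨c, hc, h⟩ := hpos x hx
  have h1 : x * x = -(c • 1) := by rw [← h, hsx, neg_mul, neg_neg]
  refine ⟨(√c)⁻¹, inv_ne_zero (Real.sqrt_pos.2 hc).ne', ?_⟩
  rw [smul_mul_smul_comm, h1, smul_neg, smul_smul, ← mul_inv, Real.mul_self_sqrt hc.le,
    inv_mul_cancel₀ hc.ne', one_smul]

/-- The anticommutator of two skew elements is fixed by `s`. It plays the role of an inner product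
on the skew part. -/
lemma exists_mul_add_mul_eq_smul_one (hmul : ∀ x y, s (x * y) = s y * s x)
    (hsym : ∀ x, s x = x → ∃ c : ℝ, x = c • 1) {x y : D} (hx : s x = -x) (hy : s y = -y) :
    ∃ c : ℝ, x * y + y * x = c • 1 := by
  refine hsym _ ?_
  rw [map_add, hmul, hmul, hx, hy, neg_mul_neg, neg_mul_neg, add_comm]

lemma exists_eq_smul_one_add_skew (hinv : ∀ x, s (s x) = x)
    (hsym : ∀ x, s x = x → ∃ c : ℝ, x = c • 1) (x : D) :
    ∃ (c : ℝ) (y : D), s y = -y ∧ x = c • 1 + y := by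
  obtain ⟨c, hc⟩ := hsym (x + s x) (by rw [map_add, hinv, add_comm])
  refine ⟨c / 2, (1 / 2 : ℝ) • (x - s x), ?_, ?_⟩
  · rw [map_smul, map_sub, hinv, ← smul_neg, neg_sub]
  · have h : (c / 2) • (1 : D) = (1 / 2 : ℝ) • (x + s x) := by rw [hc, smul_smul]; congr 1; ring
    rw [h]
    module

/-- Adding to `x` a multiple of a square root `u` of `-1` makes it anticommute with `u`. -/
lemma anticomm_add_half_smul {x u : D} {c : ℝ} (hu : u * u = -1) (h : x * u + u * x = c • 1) :
    (x + (c / 2) • u) * u + u * (x + (c / 2) • u) = 0 := by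
  rw [add_mul, mul_add, smul_mul_assoc, mul_smul_comm, hu]
  have : x * u + (c / 2) • (-1 : D) + (u * x + (c / 2) • (-1 : D))
      = (x * u + u * x) - c • 1 := by module
  rw [this, h, sub_self]

lemma anticomm_add_smul {x u v : D} (c : ℝ) (hx : x * u + u * x = 0) (hv : v * u + u * v = 0) :
    (x + c • v) * u + u * (x + c • v) = 0 := by
  rw [add_mul, mul_add, smul_mul_assoc, mul_smul_comm]
  have : x * u + c • (v * u) + (u * x + c • (u * v)) = (x * u + u * x) + c • (v * u + u * v) := by
    module
  rw [this, hx, hv, smul_zero, add_zero]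

/-- Frobenius' argument: every element is a scalar plus a skew element, and the skew part is zero, a
line `ℝ i`, or contains anticommuting `i`, `j` with square `-1`. In the last case `i`, `j`, `i j`
span it. -/
theorem exists_algEquiv_of_positive_involution [Nontrivial D]
    (hmul : ∀ x y, s (x * y) = s y * s x) (hinv : ∀ x, s (s x) = x)
    (hsym : ∀ x, s x = x → ∃ c : ℝ, x = c • 1)
    (hpos : ∀ x, x ≠ 0 → ∃ c : ℝ, 0 < c ∧ s x * x = c • 1) :
    ∃ K : DivType, Nonempty (D ≃ₐ[ℝ] K.Alg) := by
  by_cases h0 : ∀ x, s x = -x → x = 0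
  · have hbij : Function.Bijective (Algebra.ofId ℝ D) := by
      refine ⟨(Algebra.ofId ℝ D).toRingHom.injective, fun x => ?_⟩
      obtain ⟨c, y, hy, rfl⟩ := exists_eq_smul_one_add_skew hinv hsym x
      exact ⟨c, by rw [h0 y hy, add_zero, Algebra.ofId_apply, Algebra.algebraMap_eq_smul_one]⟩
    exact ⟨.real, ⟨(AlgEquiv.ofBijective _ hbij).symm⟩⟩
  push Not at h0
  obtain ⟨x, hsx, hx⟩ := h0
  obtain ⟨i, hsi, hi⟩ : ∃ i : D, s i = -i ∧ i * i = -1 := by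
    obtain ⟨r, -, hr⟩ := exists_skew_sq_eq_neg_one hpos hx hsx
    exact ⟨r • x, by rw [map_smul, hsx, smul_neg], hr⟩
  by_cases h1 : ∀ x, s x = -x → ∃ c : ℝ, x = c • i
  · let φ : ℂ →ₐ[ℝ] D := Complex.lift ⟨i, hi⟩
    have hbij : Function.Bijective φ := by
      refine ⟨φ.toRingHom.injective, fun x => ?_⟩
      obtain ⟨c, y, hy, rfl⟩ := exists_eq_smul_one_add_skew hinv hsym x
      obtain ⟨d, rfl⟩ := h1 y hy
      refine ⟨⟨c, d⟩, ?_⟩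
      simp [φ, Complex.liftAux_apply, Algebra.algebraMap_eq_smul_one]
    exact ⟨.complex, ⟨(AlgEquiv.ofBijective φ hbij).symm⟩⟩
  push Not at h1
  obtain ⟨y, hsy, hy⟩ := h1
  obtain ⟨j, hsj, hj, hji⟩ : ∃ j : D, s j = -j ∧ j * j = -1 ∧ j * i + i * j = 0 := by
    obtain ⟨c, hc⟩ := exists_mul_add_mul_eq_smul_one hmul hsym hsy hsi
    have hsz : s (y + (c / 2) • i) = -(y + (c / 2) • i) := by
      rw [map_add, map_smul, hsy, hsi, smul_neg, neg_add]
    have hz : y + (c / 2) • i ≠ 0 := fun h => hy (-(c / 2)) (by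
      rw [neg_smul]
      exact eq_neg_of_add_eq_zero_left h)
    obtain ⟨r, -, hr⟩ := exists_skew_sq_eq_neg_one hpos hz hsz
    refine ⟨r • (y + (c / 2) • i), by rw [map_smul, hsz, smul_neg], hr, ?_⟩
    rw [smul_mul_assoc, mul_smul_comm, ← smul_add, anticomm_add_half_smul hi hc, smul_zero]
  have hji' : j * i = -(i * j) := eq_neg_of_add_eq_zero_left hji
  let b : QuaternionAlgebra.Basis D (-1 : ℝ) 0 (-1) :=
    { i := i
      j := j
      k := i * j
      i_mul_i := by simp [hi]
      j_mul_j := by simp [hj]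
      i_mul_j := rfl
      j_mul_i := by simp [hji'] }
  let φ : ℍ[ℝ] →ₐ[ℝ] D := QuaternionAlgebra.lift b
  have hsk : s (i * j) = -(i * j) := by rw [hmul, hsi, hsj, neg_mul_neg, hji']
  have hk : (i * j) * (i * j) = -1 := by
    rw [mul_assoc, ← mul_assoc j, hji', neg_mul, mul_assoc, hj, mul_neg, mul_neg, mul_one, mul_neg,
      neg_neg,
      hi]
  have hik : i * (i * j) + (i * j) * i = 0 := by
    rw [mul_assoc i j i, hji', mul_neg, add_neg_cancel]
  have hjk : j * (i * j) + (i * j) * j = 0 := by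
    rw [← mul_assoc, hji', neg_mul, neg_add_cancel]
  have hbij : Function.Bijective φ := by
    refine ⟨φ.toRingHom.injective, fun x => ?_⟩
    obtain ⟨c, y, hy, rfl⟩ := exists_eq_smul_one_add_skew hinv hsym x
    obtain ⟨α, hα⟩ := exists_mul_add_mul_eq_smul_one hmul hsym hy hsi
    obtain ⟨β, hβ⟩ := exists_mul_add_mul_eq_smul_one hmul hsym hy hsj
    obtain ⟨γ, hγ⟩ := exists_mul_add_mul_eq_smul_one hmul hsym hy hsk
    -- Gram–Schmidt: the corrected element `z` anticommutes with `i`, `j` and `i j`. Anticommuting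
    -- with `i` and `j` it commutes with `i j`, so `2 (i j) z = 0` and `z = 0`.
    have hz : y + (α / 2) • i + (β / 2) • j + (γ / 2) • (i * j) = 0 := by
      set z := y + (α / 2) • i + (β / 2) • j + (γ / 2) • (i * j) with hzdef
      have hzi : z * i + i * z = 0 :=
        anticomm_add_smul _ (anticomm_add_smul _ (anticomm_add_half_smul hi hα) hji)
          (by rw [add_comm]; exact hik)
      have hzj : z * j + j * z = 0 := by
        have hz' : z = y + (β / 2) • j + (α / 2) • i + (γ / 2) • (i * j) := by rw [hzdef]; abel
        rw [hz']
        exact anticomm_add_smul _ (anticomm_add_smul _ (anticomm_add_half_smul hj hβ)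
          (by rw [add_comm]; exact hji)) (by rw [add_comm]; exact hjk)
      have hzk : z * (i * j) + (i * j) * z = 0 := by
        have hz' : z = y + (γ / 2) • (i * j) + (α / 2) • i + (β / 2) • j := by rw [hzdef]; abel
        rw [hz']
        exact anticomm_add_smul _ (anticomm_add_smul _ (anticomm_add_half_smul hk hγ) hik) hjk
      have hzk' : z * (i * j) = (i * j) * z := by
        rw [← mul_assoc, eq_neg_of_add_eq_zero_left hzi, neg_mul, mul_assoc,
          eq_neg_of_add_eq_zero_left hzj, mul_neg, neg_neg, mul_assoc]
      rw [hzk', ← two_smul ℝ] at hzk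
      have hkz : (i * j) * z = 0 := (smul_eq_zero.1 hzk).resolve_left two_ne_zero
      have := congrArg ((i * j) * ·) hkz
      simpa [← mul_assoc, hk] using this
    have hy' : y = -((α / 2) • i) - (β / 2) • j - (γ / 2) • (i * j) := by
      rw [← sub_eq_zero, ← hz]
      abel
    refine ⟨⟨c, -(α / 2), -(β / 2), -(γ / 2)⟩, ?_⟩
    change b.lift _ = _
    rw [QuaternionAlgebra.Basis.lift, hy']
    simp only [Algebra.algebraMap_eq_smul_one]
    module
  exact ⟨.quaternionic, ⟨(AlgEquiv.ofBijective φ hbij).symm⟩⟩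

end Frobenius

/-! ### The endomorphism algebra of an irreducible orthogonal representation -/

section Orthogonal

variable {G U : Type*} [Group G] [NormedAddCommGroup U] [InnerProductSpace ℝ U]
  [FiniteDimensional ℝ U]

/-- The algebra of equivariant endomorphisms of an irreducible orthogonal representation is `ℝ`,
`ℂ` or `ℍ`. -/
theorem exists_algEquiv_intertwiningMap {σ : Representation ℝ G U} [σ.IsIrreducible]
    (hσ : IsOrthogonalRep σ) :
    ∃ K : DivType, Nonempty (σ.IntertwiningMap σ ≃ₐ[ℝ] K.Alg) := by
  have := nontrivial_of_isIrreducible σ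
  let : Ring (σ.IntertwiningMap σ) := Algebra.semiringToRing ℝ
  have hnt : Nontrivial (σ.IntertwiningMap σ) := by
    obtain ⟨v, hv⟩ := exists_ne (0 : U)
    refine ⟨1, 0, fun h => hv ?_⟩
    exact DFunLike.congr_fun h v
  have hmul : ∀ S T, intertwiningAdjoint hσ hσ (S * T) =
      intertwiningAdjoint hσ hσ T * intertwiningAdjoint hσ hσ S := fun S T =>
    Representation.IntertwiningMap.ext (LinearMap.adjoint_comp S.toLinearMap T.toLinearMap)
  have hinv : ∀ T, intertwiningAdjoint hσ hσ (intertwiningAdjoint hσ hσ T) = T :=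
    intertwiningAdjoint_intertwiningAdjoint hσ hσ
  have hsym : ∀ T, intertwiningAdjoint hσ hσ T = T → ∃ c : ℝ, T = c • 1 := fun T hT =>
    exists_eq_smul_one_of_isSymmetric T (isSymmetric_of_intertwiningAdjoint_eq hσ hT)
  refine exists_algEquiv_of_positive_involution (s := intertwiningAdjoint hσ hσ) hmul hinv hsym ?_
  intro T hT
  -- `T* T` is symmetric, hence a scalar `c`; its sign follows from `‖T v‖² = c ‖v‖²` at a vector
  -- with `T v ≠ 0`.
  obtain ⟨c, hc⟩ := hsym (intertwiningAdjoint hσ hσ T * T) (by rw [hmul, hinv])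
  refine ⟨c, ?_, hc⟩
  obtain ⟨v, hv⟩ : ∃ v, T v ≠ 0 := by
    by_contra hcon
    push Not at hcon
    exact hT (DFunLike.ext _ _ hcon)
  have h1 : inner ℝ (T v) (T v) = c * inner ℝ v v := by
    rw [← intertwiningAdjoint_inner_left hσ hσ T v (T v),
      ← Representation.IntertwiningMap.mul_apply, hc]
    exact real_inner_smul_left v v c
  have h2 := real_inner_self_pos.2 hv
  have h3 := real_inner_self_nonneg (x := v)
  by_contra hcon
  nlinarith

end Orthogonal

/-! ### Existence of isotypic decompositions -/

section Decomposition

variable {G E : Type*} [Group G] [NormedAddCommGroup E] [InnerProductSpace ℝ E]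
  [FiniteDimensional ℝ E] {ρ : Representation ℝ G E}

lemma IsOrthogonalRep.toRepresentation (hρ : IsOrthogonalRep ρ) (V : Subrepresentation ρ) :
    IsOrthogonalRep V.toRepresentation := fun g x y => hρ g x y

/-- The orthogonal complement of a subrepresentation. -/
def orthogonalSubrep (hρ : IsOrthogonalRep ρ) (V : Subrepresentation ρ) : Subrepresentation ρ where
  toSubmodule := V.toSubmoduleᗮ
  apply_mem_toSubmodule g v hv := by
    rw [Submodule.mem_orthogonal'] at hv ⊢
    intro u hu
    rw [hρ.inner_apply_left]
    exact hv _ (V.apply_mem_toSubmodule _ hu)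

lemma isIrreducible_of_minimal (V : Subrepresentation ρ) (hV : V.toSubmodule ≠ ⊥)
    (hmin : ∀ U : Subrepresentation ρ, U.toSubmodule ≤ V.toSubmodule → U.toSubmodule ≠ ⊥ →
      Module.finrank ℝ V.toSubmodule ≤ Module.finrank ℝ U.toSubmodule) :
    V.toRepresentation.IsIrreducible := by
  have hnt : Nontrivial (Subrepresentation V.toRepresentation) := by
    refine ⟨⊥, ⊤, fun h => hV ?_⟩
    have h1 : (⊥ : Submodule ℝ V.toSubmodule) = ⊤ :=
      congrArg Subrepresentation.toSubmodule h
    rw [eq_bot_iff]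
    intro v hv
    have h2 : (⟨v, hv⟩ : V.toSubmodule) ∈ (⊥ : Submodule ℝ V.toSubmodule) := h1 ▸ Submodule.mem_top
    exact congrArg Subtype.val ((Submodule.mem_bot ℝ).1 h2)
  refine ⟨fun X => ?_⟩
  by_cases hX : X.toSubmodule = ⊥
  · exact Or.inl (Subrepresentation.toSubmodule_injective hX)
  · refine Or.inr (Subrepresentation.toSubmodule_injective ?_)
    let U : Subrepresentation ρ :=
      { toSubmodule := X.toSubmodule.map V.toSubmodule.subtype
        apply_mem_toSubmodule := by
          rintro g _ ⟨x, hx, rfl⟩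
          exact ⟨V.toRepresentation g x, X.apply_mem_toSubmodule g hx, rfl⟩ }
    have hU : Module.finrank ℝ U.toSubmodule = Module.finrank ℝ X.toSubmodule :=
      Submodule.finrank_map_subtype_eq _ X.toSubmodule
    have h1 := hmin U (Submodule.map_subtype_le _ _) fun h =>
      hX (Submodule.map_injective_of_injective V.toSubmodule.injective_subtype
        (h.trans (Submodule.map_bot _).symm))
    exact Submodule.eq_top_of_finrank_eq (le_antisymm (Submodule.finrank_le _) (hU ▸ h1))

/-- A nonzero invariant subspace of least dimension inside `V` is irreducible. -/
lemma exists_irreducible_le (V : Subrepresentation ρ) (hV : V.toSubmodule ≠ ⊥) :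
    ∃ U : Subrepresentation ρ, U.toSubmodule ≤ V.toSubmodule ∧ U.toSubmodule ≠ ⊥ ∧
      U.toRepresentation.IsIrreducible := by
  classical
  let p : ℕ → Prop := fun k => ∃ U : Subrepresentation ρ, U.toSubmodule ≤ V.toSubmodule ∧
    U.toSubmodule ≠ ⊥ ∧ Module.finrank ℝ U.toSubmodule = k
  have hp : ∃ k, p k := ⟨_, V, le_rfl, hV, rfl⟩
  obtain ⟨U, hUV, hU, hk⟩ := Nat.find_spec hp
  refine ⟨U, hUV, hU, isIrreducible_of_minimal U hU fun X hXU hX => ?_⟩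
  rw [hk]
  exact Nat.find_min' hp ⟨X, hXU.trans hUV, hX, rfl⟩

/-- An orthogonal representation is an orthogonal sum of irreducible subrepresentations. -/
lemma exists_orthogonal_irreducible_family (hρ : IsOrthogonalRep ρ) (k : ℕ)
    (V : Subrepresentation ρ) (hk : Module.finrank ℝ V.toSubmodule ≤ k) :
    ∃ (ι : Type) (_ : Fintype ι) (W : ι → Subrepresentation ρ),
      (∀ s, (W s).toRepresentation.IsIrreducible) ∧
      (∀ s t, s ≠ t → (W s).toSubmodule ⟂ (W t).toSubmodule) ∧
      ⨆ s, (W s).toSubmodule = V.toSubmodule := by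
  induction k generalizing V with
  | zero =>
    refine ⟨Empty, inferInstance, Empty.elim, fun s => s.elim, fun s => s.elim, ?_⟩
    rw [iSup_of_empty]
    exact (Submodule.finrank_eq_zero.1 (Nat.le_zero.1 hk)).symm
  | succ k ih =>
    by_cases hV : V.toSubmodule = ⊥
    · refine ⟨Empty, inferInstance, Empty.elim, fun s => s.elim, fun s => s.elim, ?_⟩
      rw [iSup_of_empty, hV]
    obtain ⟨U, hUV, hU, hirr⟩ := exists_irreducible_le V hV
    -- Split off `U` and continue in `Uᗮ ⊓ V`, which is invariant and of smaller dimension since the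
    -- nonzero `U` is not orthogonal to itself.
    have hsup : U.toSubmodule ⊔ U.toSubmoduleᗮ ⊓ V.toSubmodule = V.toSubmodule :=
      Submodule.sup_orthogonal_inf_of_hasOrthogonalProjection hUV
    have hlt : Module.finrank ℝ (orthogonalSubrep hρ U ⊓ V).toSubmodule
        < Module.finrank ℝ V.toSubmodule := by
      refine Submodule.finrank_lt_finrank_of_lt (lt_of_le_of_ne inf_le_right fun h => hU ?_)
      have h1 : V.toSubmodule ≤ U.toSubmoduleᗮ := inf_eq_right.1 h
      exact (Submodule.isOrtho_self).1 (hUV.trans h1)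
    obtain ⟨ι, hι, W, hW, hort, hWsup⟩ := ih (orthogonalSubrep hρ U ⊓ V) (by omega)
    have hWU : ∀ s, (W s).toSubmodule ≤ U.toSubmoduleᗮ := fun s =>
      (le_iSup (fun s => (W s).toSubmodule) s).trans (hWsup.le.trans inf_le_left)
    refine ⟨Option ι, inferInstance, fun s => s.elim U W, ?_, ?_, ?_⟩
    · rintro (_ | s)
      · exact hirr
      · exact hW s
    · rintro (_ | s) (_ | t) hst
      · exact absurd rfl hst
      · exact Submodule.IsOrtho.symm (hWU t)
      · exact hWU s
      · exact hort s t fun h => hst (congrArg some h)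
    · rw [iSup_option]
      simp only [Option.elim]
      rw [hWsup]
      exact hsup

/-- Conjugation by an isomorphism of representations. -/
def intertwiningConj {U W : Type*} [AddCommGroup U] [Module ℝ U] [AddCommGroup W] [Module ℝ W]
    {σ : Representation ℝ G U} {τ : Representation ℝ G W} (φ : σ.Equiv τ) :
    σ.IntertwiningMap σ ≃ₐ[ℝ] τ.IntertwiningMap τ where
  toFun T := (φ.toIntertwiningMap.comp T).comp φ.symm.toIntertwiningMap
  invFun T := (φ.symm.toIntertwiningMap.comp T).comp φ.toIntertwiningMap
  left_inv T := by ext x; simp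
  right_inv T := by ext x; simp
  map_mul' S T := by ext x; simp
  map_add' S T := by ext x; simp
  commutes' c := by ext x; simp

end Decomposition

section Holonomy

variable {n : ℕ} (π : Subgroup (Iso n))

lemma isOrthogonalRep_holonomyRep : IsOrthogonalRep (holonomyRep π) := by
  intro h x y
  have h1 := star_mul_self_of_mem_holonomy π h.2
  have h2 := inner_star_apply ((h : GLn n) : Euc n →L[ℝ] Euc n)
    (((h : GLn n) : Euc n →L[ℝ] Euc n) x) y
  rw [← mul_apply_eq_comp, h1] at h2
  exact h2.symm

/-- The irreducible summands of an orthogonal splitting are grouped by isomorphism class. The type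
of a class is read off a representative and carried to the other members by conjugation. -/
theorem nonempty_isotypicDecomposition : Nonempty (IsotypicDecomposition π) := by
  classical
  have hρ := isOrthogonalRep_holonomyRep π
  obtain ⟨ι, _, W, hW, hort, hsup⟩ :=
    exists_orthogonal_irreducible_family hρ _ (⊤ : Subrepresentation (holonomyRep π)) le_rfl
  let r : Setoid ι :=
    { r := fun s t => Nonempty ((W s).toRepresentation.Equiv (W t).toRepresentation)
      iseqv := ⟨fun s => ⟨.refl _⟩, fun ⟨φ⟩ => ⟨φ.symm⟩, fun ⟨φ⟩ ⟨ψ⟩ => ⟨φ.trans ψ⟩⟩ }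
  let e : Quotient r ≃ Fin (Fintype.card (Quotient r)) := Fintype.equivFin _
  let c : Fin (Fintype.card (Quotient r)) → Type := fun i => {s : ι // e ⟦s⟧ = i}
  let f : ∀ i, Fin (Fintype.card (c i)) ≃ c i := fun i => (Fintype.equivFin _).symm
  let rep : Fin (Fintype.card (Quotient r)) → ι := fun i => (e.symm i).out
  have hrep : ∀ i, e ⟦rep i⟧ = i := fun i => by simp [rep]
  have htype : ∀ s, ∃ K : DivType, Nonempty
      ((W s).toRepresentation.IntertwiningMap (W s).toRepresentation ≃ₐ[ℝ] K.Alg) := fun s =>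
    haveI := hW s
    exists_algEquiv_intertwiningMap (hρ.toRepresentation (W s))
  choose K hK using htype
  have hiff : ∀ s t, Nonempty ((W s).toRepresentation.Equiv (W t).toRepresentation) ↔
      e ⟦s⟧ = e ⟦t⟧ := fun s t => by
    rw [e.injective.eq_iff, Quotient.eq]
    rfl
  let idx : ((i : Fin (Fintype.card (Quotient r))) × Fin (Fintype.card (c i))) → ι :=
    fun p => (f p.1 p.2).1
  have hidx : Function.Injective idx := by
    rintro ⟨i, j⟩ ⟨i', j'⟩ h
    have h1 : i = i' := by
      rw [← (f i j).2, ← (f i' j').2]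
      exact congrArg (fun s => e ⟦s⟧) h
    subst h1
    have h2 : f i j = f i j' := Subtype.ext h
    rw [(f i).injective h2]
  have hidx' : Function.Surjective idx := fun s =>
    ⟨⟨e ⟦s⟧, (f _).symm ⟨s, rfl⟩⟩, by simp [idx]⟩
  refine ⟨{
    l := Fintype.card (Quotient r)
    m := fun i => Fintype.card (c i)
    K := fun i => K (rep i)
    V := fun i j => W (idx ⟨i, j⟩)
    m_pos := fun i => Fintype.card_pos_iff.2 ⟨⟨rep i, hrep i⟩⟩
    isInternal := ?_
    irreducible := fun i j => hW _
    equiv_iff := fun i j i' j' => ?_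
    type_eq := fun i j => ?_ }⟩
  · have hfam : OrthogonalFamily ℝ (fun p => (W (idx p)).toSubmodule)
        fun p => (W (idx p)).toSubmodule.subtypeₗᵢ :=
      OrthogonalFamily.of_pairwise fun p q hpq => hort _ _ fun h => hpq (hidx h)
    have htop : ⨆ p, (W (idx p)).toSubmodule = ⊤ := by
      rw [hidx'.iSup_comp (g := fun s => (W s).toSubmodule), hsup]
      rfl
    exact hfam.isInternal_iff.2 (by rw [htop, Submodule.top_orthogonal_eq_bot])
  · rw [hiff]
    change e ⟦(f i j).1⟧ = e ⟦(f i' j').1⟧ ↔ i = i'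
    rw [(f i j).2, (f i' j').2]
  · obtain ⟨φ⟩ := (hiff (idx ⟨i, j⟩) (rep i)).2 (((f i j).2).trans (hrep i).symm)
    obtain ⟨ψ⟩ := hK (rep i)
    exact ⟨(intertwiningConj φ).trans ψ⟩

end Holonomy

/-! ### The dimension of the space of selfadjoint equivariant operators -/

section Component

variable {E ι : Type*} [AddCommGroup E] [Module ℝ E] [DecidableEq ι] {A : ι → Submodule ℝ E}

/-- The components of a vector with respect to a direct sum decomposition. -/
def internalComponent (h : DirectSum.IsInternal A) (s : ι) : E →ₗ[ℝ] A s :=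
  DirectSum.component ℝ ι (fun s => A s) s ∘ₗ
    (LinearEquiv.ofBijective (DirectSum.coeLinearMap A) h).symm.toLinearMap

lemma internalComponent_coe (h : DirectSum.IsInternal A) (s t : ι) (u : A t) :
    internalComponent h s u = DirectSum.lof ℝ ι (fun s => A s) t u s := by
  have h1 : (LinearEquiv.ofBijective (DirectSum.coeLinearMap A) h).symm (u : E)
      = DirectSum.lof ℝ ι (fun s => A s) t u := by
    rw [LinearEquiv.symm_apply_eq]
    exact (DirectSum.coeLinearMap_lof A t u).symm
  change (LinearEquiv.ofBijective (DirectSum.coeLinearMap A) h).symm (u : E) s = _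
  rw [h1]

lemma internalComponent_coe_self (h : DirectSum.IsInternal A) (s : ι) (u : A s) :
    internalComponent h s u = u := by
  rw [internalComponent_coe]
  exact DirectSum.of_eq_same (β := fun s => A s) s u

lemma internalComponent_coe_ne (h : DirectSum.IsInternal A) {s t : ι} (hst : s ≠ t) (u : A t) :
    internalComponent h s u = 0 := by
  rw [internalComponent_coe]
  exact DirectSum.of_eq_of_ne (β := fun s => A s) t s u hst

lemma sum_internalComponent [Fintype ι] (h : DirectSum.IsInternal A) (x : E) :
    ∑ s, (internalComponent h s x : E) = x := by
  classical
  refine Eq.trans ?_ ((LinearEquiv.ofBijective (DirectSum.coeLinearMap A) h).apply_symm_apply x)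
  change _ = DirectSum.coeLinearMap A _
  rw [DirectSum.coeLinearMap_eq_dfinsuppSum, DFinsupp.sum_eq_sum_fintype _ fun _ => rfl]
  rfl

end Component

/-! ### Selfadjoint equivariant operators as symmetric arrays of blocks -/

section Blocks

variable {G E ι : Type*} [Group G] [NormedAddCommGroup E] [InnerProductSpace ℝ E]
  [FiniteDimensional ℝ E] {ρ : Representation ℝ G E} {V : ι → Subrepresentation ρ}

lemma internalComponent_equivariant [Fintype ι] [DecidableEq ι]
    (h : DirectSum.IsInternal fun s => (V s).toSubmodule)
    (s : ι) (g : G) (x : E) :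
    internalComponent h s (ρ g x) = (V s).toRepresentation g (internalComponent h s x) := by
  conv_lhs => rw [← sum_internalComponent h x, map_sum, map_sum]
  have key : ∀ t, ρ g (internalComponent h t x : E)
      = (((V t).toRepresentation g (internalComponent h t x) : (V t).toSubmodule) : E) :=
    fun t => rfl
  simp only [key]
  rw [Finset.sum_eq_single s (fun t _ hts => internalComponent_coe_ne h hts.symm _) (by simp),
    internalComponent_coe_self]

/-- Transposition of blocks. -/
def blockAdjoint (hρ : IsOrthogonalRep ρ) (V : ι → Subrepresentation ρ) (s t : ι) :
    (V s).toRepresentation.IntertwiningMap (V t).toRepresentation →ₗ[ℝ]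
      (V t).toRepresentation.IntertwiningMap (V s).toRepresentation :=
  intertwiningAdjoint (hρ.toRepresentation (V s)) (hρ.toRepresentation (V t))

/-- A block of an equivariant operator. -/
def block (hρ : IsOrthogonalRep ρ) (V : ι → Subrepresentation ρ) {T : E →L[ℝ] E}
    (hT : ∀ g x, T (ρ g x) = ρ g (T x)) (s t : ι) :
    (V s).toRepresentation.IntertwiningMap (V t).toRepresentation where
  toLinearMap := LinearMap.adjoint (V t).toSubmodule.subtype ∘ₗ (T : E →ₗ[ℝ] E) ∘ₗ
    (V s).toSubmodule.subtype
  isIntertwining' g := by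
    ext1 x
    have h1 := isIntertwining_adjoint (hρ.toRepresentation (V t)) hρ
      (T := (V t).toSubmodule.subtype) (fun _ _ => rfl) g (T x)
    rw [← hT] at h1
    exact h1

lemma inner_block (hρ : IsOrthogonalRep ρ) (V : ι → Subrepresentation ρ) {T : E →L[ℝ] E}
    (hT : ∀ g x, T (ρ g x) = ρ g (T x)) (s t : ι) (u : (V s).toSubmodule)
    (w : (V t).toSubmodule) :
    inner ℝ (block hρ V hT s t u) w = inner ℝ (T (u : E)) (w : E) :=
  LinearMap.adjoint_inner_left (V t).toSubmodule.subtype w (T u)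

variable [CompleteSpace E]

/-- The blocks of a selfadjoint equivariant operator. -/
def blockArray (hρ : IsOrthogonalRep ρ) (V : ι → Subrepresentation ρ)
    {S : Submodule ℝ (E →L[ℝ] E)}
    (hS : ∀ T, T ∈ S ↔ IsSelfAdjoint T ∧ ∀ g x, T (ρ g x) = ρ g (T x)) :
    S →ₗ[ℝ] symmArray (blockAdjoint hρ V) where
  toFun T := ⟨fun s t => block hρ V ((hS T).1 T.2).2 s t, fun s t => by
    refine DFunLike.ext _ _ fun w => ext_inner_right ℝ fun u => ?_
    refine (intertwiningAdjoint_inner_left _ _ _ u w).trans ?_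
    rw [inner_block, real_inner_comm, inner_block, ((hS T).1 T.2).1.inner_apply_comm,
      real_inner_comm]⟩
  map_add' S T := by
    refine Subtype.ext (funext fun s => funext fun t => DFunLike.ext _ _ fun u => ?_)
    exact map_add (LinearMap.adjoint (V t).toSubmodule.subtype) _ _
  map_smul' c T := by
    refine Subtype.ext (funext fun s => funext fun t => DFunLike.ext _ _ fun u => ?_)
    exact map_smul (LinearMap.adjoint (V t).toSubmodule.subtype) _ _

lemma inner_blockArray (hρ : IsOrthogonalRep ρ) {S : Submodule ℝ (E →L[ℝ] E)}
    (hS : ∀ T, T ∈ S ↔ IsSelfAdjoint T ∧ ∀ g x, T (ρ g x) = ρ g (T x)) (T : S) (s t : ι)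
    (u : (V s).toSubmodule) (w : (V t).toSubmodule) :
    inner ℝ ((blockArray hρ V hS T).1 s t u) w = inner ℝ (T.1 (u : E)) (w : E) :=
  inner_block hρ V ((hS T).1 T.2).2 s t u w

/-- The summands need not be orthogonal, so the blocks record the form `⟪T u, w⟫` on pairs of
summands instead of the components of `T u`. As the summands span, this form determines `T`. -/
lemma bijective_blockArray [Fintype ι] [DecidableEq ι] (hρ : IsOrthogonalRep ρ)
    (h : DirectSum.IsInternal fun s => (V s).toSubmodule) {S : Submodule ℝ (E →L[ℝ] E)}
    (hS : ∀ T, T ∈ S ↔ IsSelfAdjoint T ∧ ∀ g x, T (ρ g x) = ρ g (T x)) :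
    Function.Bijective (blockArray hρ V hS) := by
  constructor
  · rw [injective_iff_map_eq_zero]
    intro T hT
    refine Subtype.ext (ContinuousLinearMap.ext fun x => ext_inner_right ℝ fun y => ?_)
    have h1 : ∀ s t (u : (V s).toSubmodule) (w : (V t).toSubmodule),
        inner ℝ (T.1 (u : E)) (w : E) = 0 := fun s t u w => by
      rw [← inner_blockArray hρ hS T s t u w, hT]
      exact inner_zero_left w
    rw [← sum_internalComponent h x, ← sum_internalComponent h y, map_sum, sum_inner]
    simp only [inner_sum, h1, Finset.sum_const_zero]
    simp
  · rintro ⟨f, hf⟩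
    -- The operator of the form that pairs the components of `x` and `y` through the blocks `f s t`;
    -- the adjoints of the component maps account for non-orthogonality.
    let T₀ : E →ₗ[ℝ] E := ∑ s, ∑ t, LinearMap.adjoint (internalComponent h t) ∘ₗ
      (f s t).toLinearMap ∘ₗ internalComponent h s
    let T : E →L[ℝ] E := LinearMap.toContinuousLinearMap T₀
    have hT : ∀ x y, inner ℝ (T x) y = ∑ s, ∑ t,
        inner ℝ (f s t (internalComponent h s x)) (internalComponent h t y) := by
      intro x y
      change inner ℝ (T₀ x) y = _
      simp only [T₀, LinearMap.sum_apply, sum_inner, LinearMap.comp_apply,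
        LinearMap.adjoint_inner_left]
      rfl
    have hf' : ∀ s t u w, inner ℝ (f s t u) w = inner ℝ u (f t s w) := fun s t u w => by
      rw [real_inner_comm, ← hf t s]
      exact (real_inner_comm _ _).trans (intertwiningAdjoint_inner_left _ _ _ w u)
    have hTS : T ∈ S := by
      refine (hS T).2 ⟨?_, fun g x => ?_⟩
      · rw [ContinuousLinearMap.isSelfAdjoint_iff_isSymmetric]
        intro x y
        change inner ℝ (T x) y = inner ℝ x (T y)
        rw [real_inner_comm _ x, hT, hT, Finset.sum_comm]
        refine Finset.sum_congr rfl fun t _ => Finset.sum_congr rfl fun s _ => ?_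
        rw [hf', real_inner_comm]
      · refine ext_inner_right ℝ fun y => ?_
        obtain ⟨z, rfl⟩ : ∃ z, ρ g z = y := ⟨_, rep_apply_inv_apply ρ g y⟩
        rw [hρ, hT, hT]
        refine Finset.sum_congr rfl fun s _ => Finset.sum_congr rfl fun t _ => ?_
        rw [internalComponent_equivariant, internalComponent_equivariant,
          Representation.IntertwiningMap.isIntertwining]
        exact hρ.toRepresentation (V t) g _ _
    refine ⟨⟨T, hTS⟩, Subtype.ext (funext fun s => funext fun t =>
      DFunLike.ext _ _ fun u => ext_inner_right ℝ fun w => ?_)⟩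
    rw [inner_blockArray, hT]
    rw [Finset.sum_eq_single s, Finset.sum_eq_single t, internalComponent_coe_self,
      internalComponent_coe_self]
    · intro t' _ ht'
      rw [internalComponent_coe_ne h ht', inner_zero_right]
    · simp
    · intro s' _ hs'
      refine Finset.sum_eq_zero fun t' _ => ?_
      rw [internalComponent_coe_ne h hs', map_zero, inner_zero_left]
    · simp

lemma finrank_symmDiag_blockAdjoint (hρ : IsOrthogonalRep ρ) (s : ι)
    (hs : (V s).toRepresentation.IsIrreducible) :
    Module.finrank ℝ (symmDiag (blockAdjoint hρ V) s) = 1 := by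
  have hσ := hρ.toRepresentation (V s)
  have hnt := nontrivial_of_isIrreducible (V s).toRepresentation
  refine finrank_eq_one (⟨1, ?_⟩ : symmDiag (blockAdjoint hρ V) s) ?_ fun T => ?_
  · refine DFunLike.ext _ _ fun u => ext_inner_right ℝ fun w => ?_
    exact intertwiningAdjoint_inner_left hσ hσ 1 w u
  · intro h0
    obtain ⟨v, hv⟩ := exists_ne (0 : (V s).toSubmodule)
    exact hv (DFunLike.congr_fun (congrArg Subtype.val h0) v)
  · obtain ⟨c, hc⟩ := exists_eq_smul_one_of_isSymmetric T.1
      (isSymmetric_of_intertwiningAdjoint_eq hσ T.2)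
    exact ⟨c, Subtype.ext hc.symm⟩

end Blocks

/-! ### The dimension count for the holonomy representation -/

section Holonomy

variable {n : ℕ} {π : Subgroup (Iso n)} (D : IsotypicDecomposition π)

lemma mem_symPart_holonomyCommutant (T : Euc n →L[ℝ] Euc n) :
    T ∈ symPart (holonomyCommutant π) ↔
      IsSelfAdjoint T ∧ ∀ g x, T (holonomyRep π g x) = holonomyRep π g (T x) := by
  rw [mem_symPart, mem_holonomyCommutant_iff, and_comm]
  refine and_congr_right fun _ => ⟨fun H g x => ?_, fun H h hh => ?_⟩
  · exact (DFunLike.congr_fun (H g g.2) x).symm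
  · exact ContinuousLinearMap.ext fun x => (H ⟨h, hh⟩ x).symm

/-- Schur's lemma: without an isomorphism every equivariant map is zero, and composing with an
isomorphism reduces the other case to endomorphisms. -/
lemma finrank_intertwiningMap_isotypic (s t : (i : Fin D.l) × Fin (D.m i)) :
    Module.finrank ℝ ((D.V s.1 s.2).toRepresentation.IntertwiningMap
      (D.V t.1 t.2).toRepresentation) = if s.1 = t.1 then (D.K s.1).realDim else 0 := by
  have := D.irreducible s.1 s.2
  have := D.irreducible t.1 t.2
  split_ifs with h
  · obtain ⟨φ⟩ := (D.equiv_iff s.1 s.2 t.1 t.2).2 h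
    obtain ⟨ψ⟩ := D.type_eq s.1 s.2
    rw [← DivType.finrank_alg, ← ψ.toLinearEquiv.finrank_eq]
    refine LinearEquiv.finrank_eq (LinearEquiv.ofLinearMap
      (Representation.IntertwiningMap.llcomp _ _ _ φ.symm.toIntertwiningMap)
      (Representation.IntertwiningMap.llcomp _ _ _ φ.toIntertwiningMap) ?_ ?_)
    · exact LinearMap.ext fun T => DFunLike.ext _ _ fun x => φ.symm_apply_apply (T x)
    · exact LinearMap.ext fun T => DFunLike.ext _ _ fun x => φ.apply_symm_apply (T x)
  · have hempty : IsEmpty ((D.V s.1 s.2).toRepresentation.Equiv (D.V t.1 t.2).toRepresentation) :=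
      ⟨fun φ => h ((D.equiv_iff s.1 s.2 t.1 t.2).1 ⟨φ⟩)⟩
    exact Module.finrank_zero_of_subsingleton

theorem finrank_symPart_holonomyCommutant :
    Module.finrank ℝ (symPart (holonomyCommutant π)) = D.dim := by
  classical
  have hρ := isOrthogonalRep_holonomyRep π
  let V : ((i : Fin D.l) × Fin (D.m i)) → Subrepresentation (holonomyRep π) := fun s => D.V s.1 s.2
  have hbij := bijective_blockArray (V := V) hρ D.isInternal
    (mem_symPart_holonomyCommutant (π := π))
  rw [(LinearEquiv.ofBijective _ hbij).finrank_eq]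
  have h := two_mul_finrank_symmArray (τ := blockAdjoint hρ V)
    (fun s t T => intertwiningAdjoint_intertwiningAdjoint _ _ T)
    (fun s => finrank_symmDiag_blockAdjoint hρ s (D.irreducible s.1 s.2))
  -- In the row of `s` only the `m - 1` other summands of its isotypic component contribute.
  have h2 : ∀ s : (i : Fin D.l) × Fin (D.m i), (∑ t, if s = t then 0 else
      Module.finrank ℝ ((V s).toRepresentation.IntertwiningMap (V t).toRepresentation))
      = (D.m s.1 - 1) * (D.K s.1).realDim := by
    intro s
    have h3 : ∀ t, (if s = t then 0 else Module.finrank ℝ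
        ((V s).toRepresentation.IntertwiningMap (V t).toRepresentation))
        = if s.1 = t.1 then (if s = t then 0 else (D.K s.1).realDim) else 0 := by
      intro t
      rw [finrank_intertwiningMap_isotypic D s t]
      split_ifs <;> rfl
    simp only [h3]
    rw [Fintype.sum_sigma, Finset.sum_eq_single s.1]
    · obtain ⟨i, j⟩ := s
      simp only [if_true, Sigma.mk.injEq, heq_eq_eq, true_and]
      rw [Finset.sum_ite, Finset.sum_const_zero, zero_add, Finset.sum_const, smul_eq_mul,
        Finset.filter_ne, Finset.card_erase_of_mem (Finset.mem_univ j), Finset.card_univ,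
        Fintype.card_fin]
    · intro i _ hi
      exact Finset.sum_eq_zero fun j _ => if_neg (Ne.symm hi)
    · simp
  rw [Finset.sum_congr rfl fun s _ => h2 s, Fintype.sum_sigma, Fintype.card_sigma] at h
  simp only [Fintype.card_fin, Finset.sum_const, Finset.card_univ, smul_eq_mul] at h
  have h4 : 2 * D.dim = 2 * ∑ i, D.m i + ∑ i, D.m i * ((D.m i - 1) * (D.K i).realDim) := by
    rw [IsotypicDecomposition.dim, Finset.mul_sum, Finset.mul_sum, ← Finset.sum_add_distrib]
    refine Finset.sum_congr rfl fun i _ => ?_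
    rw [two_mul_homDim, mul_assoc]
  omega

end Holonomy

end FlatTeichmuller

end

theorem theoremB (n : ℕ) (π : Subgroup (Iso n)) (hπ : IsCrystallographic π) :
    Nonempty (IsotypicDecomposition π) ∧
    ∀ D : IsotypicDecomposition π,
      ∃ (cT : ChartedSpace (Euc D.dim) (Teich π))
        (cG : ∀ i, ChartedSpace (Euc (homDim (D.m i) (D.K i))) (HomSpace (D.m i) (D.K i))),
        IsAnalyticQuotient cT (coneIncl π) (teichMk π) ∧
        (∀ i, IsAnalyticQuotient (cG i) (glIncl (D.m i) (D.K i)) (homMk (D.m i) (D.K i))) ∧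
        Nonempty (Diffeomorph (𝓡 D.dim)
          (ModelWithCorners.pi fun i => 𝓡 (homDim (D.m i) (D.K i)))
          (Teich π) (∀ i, HomSpace (D.m i) (D.K i)) ω) ∧
        Nonempty (Diffeomorph (𝓡 D.dim) (𝓡 D.dim) (Teich π) (Euc D.dim) ω) := by
  refine ⟨nonempty_isotypicDecomposition π, fun D => ?_⟩
  obtain ⟨e, he⟩ := exists_globalChart_teich π (finrank_symPart_holonomyCommutant D)
  choose f hf using fun i => exists_globalChart_homSpace (D.m i) (D.K i)
  -- The `rfl` is the equality of `D.dim` with the sum of the dimensions of the factors.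
  exact ⟨globalChart e, fun i => globalChart (f i), he, hf,
    nonempty_diffeomorph_pi e f rfl, ⟨globalChartDiffeomorph e⟩⟩
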